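/- Bandit range searching. There are $n$ arms; arm $a$ carries a known point $p_a\in\mathbb R$ and an unknown probability distribution supported on $[0,1]$ with mean (weight) $\mu_a$. A collection of closed intervals is given. An arm $a$ with $p_a\in I$ is $\varepsilon$-optimal for $I$ if $\mu_a\ge\mu_b-\varepsilon$ for every arm $b$ with $p_b\in I$. An algorithm adaptively (and possibly with internal randomization) draws independent samples from arms of its choice, and may stop at any time and report one arm for each interval. For given points and intervals it has the $(\varepsilon,\delta)$-PAC guarantee if, whatever the distributions of the arms, with probability at least $1-\delta$ it stops and reports an $\varepsilon$-optimal arm for every interval. Theorem. For every $\delta_0<1/2$ there is a constant $c>0$, depending only on $\delta_0$, such that the following holds. Let $T_1\ge 1$ and $m\ge 2$ be integers, $\varepsilon=1/(8T_1)$, $0<\delta\le\delta_0$ and $n_1=mT_1$. Consider $n_1$ arms, $m$ of them at each of the points $1,2,\dots,T_1$, and the nested intervals $I_t=[0,t]$, $1\le t\le T_1$. Then for every algorithm that has the $(\varepsilon,\delta)$-PAC guarantee for these points and intervals there are distributions of the arms on $[0,1]$ for which the expected number of samples that it draws is at least $$c\,\frac{n_1}{\varepsilon^2}\log\frac{1}{\varepsilon\delta}.$$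 -/

import Mathlib

open MeasureTheory
open scoped ENNReal

namespace BanditRange

/-- The unknown part of a problem: for every arm, a probability distribution supported on `[0,1]`. -/
structure Arms (ι : Type*) where
  law : ι → Measure ℝ
  isProb : ∀ a, IsProbabilityMeasure (law a)
  support : ∀ a, law a (Set.Icc 0 1)ᶜ = 0

attribute [instance] Arms.isProb

/-- The weight (mean) of an arm. -/
noncomputable def Arms.weight {ι : Type*} (ν : Arms ι) (a : ι) : ℝ := ∫ x, x ∂(ν.law a)

/-- The known part of a problem: a point `p_a` for every arm `a`, and a collection of
closed intervals `[left i, right i]`, each with non-empty interior. -/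
structure RangeInstance (ι κ : Type*) where
  point : ι → ℝ
  left : κ → ℝ
  right : κ → ℝ
  left_lt_right : ∀ i, left i < right i

/-- The set of arms whose point lies in the `i`-th interval. -/
def RangeInstance.armsIn {ι κ : Type*} (R : RangeInstance ι κ) (i : κ) : Set ι :=
  {a | R.left i ≤ R.point a ∧ R.point a ≤ R.right i}

/-- The arm `a` is `ε`-optimal for the `i`-th interval. -/
def RangeInstance.IsOptimal {ι κ : Type*} (R : RangeInstance ι κ) (ν : Arms ι) (ε : ℝ)
    (i : κ) (a : ι) : Prop :=
  a ∈ R.armsIn i ∧ ∀ b ∈ R.armsIn i, ν.weight b - ε ≤ ν.weight a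

/-- An adaptive sampling algorithm whose internal randomness is a point `u` of `Ω`. After `t`
samples, with observed values `h 0, …, h (t-1)`, it either samples an arm `a`
(`next t u h = Sum.inl a`), or it stops and reports one arm per interval
(`next t u h = Sum.inr out`). The arms sampled so far are determined by `u` and `h`. -/
structure Algorithm (Ω ι κ : Type*) [MeasurableSpace Ω] where
  next : (t : ℕ) → Ω → (Fin t → ℝ) → ι ⊕ (κ → ι)
  measurable_next : ∀ t x, MeasurableSet {q : Ω × (Fin t → ℝ) | next t q.1 q.2 = x}

namespace Algorithm

variable {Ω ι κ : Type*} [MeasurableSpace Ω]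

/-- The first `t` observed values, when sampling arm `a` in round `s` returns `ω s a`.
The value `0` recorded once the algorithm has stopped plays no role below. -/
def observed (A : Algorithm Ω ι κ) (u : Ω) (ω : ℕ → ι → ℝ) : (t : ℕ) → Fin t → ℝ
  | 0 => Fin.elim0
  | t + 1 => Fin.snoc (α := fun _ => ℝ) (A.observed u ω t)
      (Sum.elim (fun a => ω t a) (fun _ => 0) (A.next t u (A.observed u ω t)))

/-- The algorithm stops after exactly `t` samples and reports `out`. -/
def StopsWith (A : Algorithm Ω ι κ) (u : Ω) (ω : ℕ → ι → ℝ) (t : ℕ) (out : κ → ι) : Prop :=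
  (∀ s < t, ∃ a, A.next s u (A.observed u ω s) = Sum.inl a) ∧
    A.next t u (A.observed u ω t) = Sum.inr out

/-- The number of samples drawn (`⊤` if the algorithm never stops). -/
noncomputable def numSamples (A : Algorithm Ω ι κ) (u : Ω) (ω : ℕ → ι → ℝ) : ℝ≥0∞ :=
  ⨅ (t : ℕ) (_ : ∃ out, A.StopsWith u ω t out), (t : ℝ≥0∞)

end Algorithm

/-- The joint law of the internal randomness and of the table of samples: all entries `ω s a` are
independent, `ω s a` has the law of arm `a`, and the table is independent of `u`. -/
noncomputable def runLaw {Ω ι : Type*} [MeasurableSpace Ω] [Fintype ι] (Q : Measure Ω)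
    (ν : Arms ι) : Measure (Ω × (ℕ → ι → ℝ)) :=
  Q.prod (Measure.infinitePi (fun _ : ℕ => Measure.pi ν.law))

/-- The expected number of samples of an algorithm on arms with distributions `ν`. -/
noncomputable def expectedSamples {Ω ι κ : Type*} [MeasurableSpace Ω] [Fintype ι]
    (Q : Measure Ω) (A : Algorithm Ω ι κ) (ν : Arms ι) : ℝ≥0∞ :=
  ∫⁻ q, A.numSamples q.1 q.2 ∂(runLaw Q ν)

/-- The `(ε, δ)`-PAC guarantee on the points and intervals `R`: whatever the distributions of the
arms, with probability at least `1 - δ` the algorithm stops and reports an `ε`-optimal arm for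
every interval. -/
def IsPAC {Ω ι κ : Type*} [MeasurableSpace Ω] [Fintype ι] (Q : Measure Ω)
    (A : Algorithm Ω ι κ) (R : RangeInstance ι κ) (ε δ : ℝ) : Prop :=
  ∀ ν : Arms ι, ENNReal.ofReal (1 - δ) ≤
    runLaw Q ν {q | ∃ t out, A.StopsWith q.1 q.2 t out ∧ ∀ i, R.IsOptimal ν ε i (out i)}

/-- The nested instance: `T` groups of `m` arms, the arms of the group with (zero-based)
index `t` sit at the point `t + 1`, and the intervals are `[0, 1], [0, 2], …, [0, T]`. -/
def nestedInstance (T m : ℕ) : RangeInstance (Fin T × Fin m) (Fin T) where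
  point a := (a.1 : ℝ) + 1
  left _ := 0
  right t := (t : ℝ) + 1
  left_lt_right _ := by positivity

end BanditRange

namespace BanditRange

open ProbabilityTheory

/-! The hard instances are indexed by `θ : Fin T → Fin m`. Group `t` has Bernoulli arms with base
mean `1/4 + 4εt`; arm `0` gets a bonus `2ε`, and arm `θ t`, if it is not `0`, gets `4ε`. The best
arm of group `t` then beats its own group and all earlier groups by at least `2ε`, so `(t, θ t)` is
the only `ε`-optimal arm for the `t`-th interval: a correct report spells out `θ`
(`isOptimal_hardArms`).

Let `θ t = 0` and `j ≠ 0`. Changing `θ t` to `j` alters the law of the single arm `(t, j)`. A report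
that is right before `t` and says `(t, 0)` at `t` has probability at least `1 - δ` before the
change; after it, this report is a first error at `t`. The inequality `l P(E) ≤ (exp l - 1) P'(E) +
χ² N`, with `N` the expected number of samples of the altered arm under `P`, makes such a change
costly (`transportation`, `le_firstErrorProb_add_armSamples`).

The extra factor `T` inside the logarithm comes from the first errors: for a fixed instance these
events are disjoint over `t`, so their probabilities sum to at most `δ` (`sum_firstErrorProb_le`),
about `δ / T` per group. A single instance cannot exploit this, as different groups are compared
with different alternatives. Averaging over a product prior giving `0` and the other values together
equal mass in each coordinate does (`samples_lower_bound_average`): the error term carries no factor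
`T`, and `exp l` of order `T / δ` is affordable. When `T / δ` is bounded, the all-zero instance
suffices (`samples_lower_bound_zero`). -/

instance isProbabilityMeasure_runLaw {Ω ι : Type*} [MeasurableSpace Ω] [Fintype ι] (Q : Measure Ω)
    [IsProbabilityMeasure Q] (ν : Arms ι) : IsProbabilityMeasure (runLaw Q ν) := by
  unfold runLaw; infer_instance

/-! ### Histories: measurability and independence of the next row. -/

namespace Algorithm

variable {Ω ι κ : Type*} [MeasurableSpace Ω]

/-- The value recorded in round `t` when the history is `h` and the row of samples is `y`. -/
def pick (A : Algorithm Ω ι κ) (t : ℕ) (p : Ω × (Fin t → ℝ)) (y : ι → ℝ) : ℝ :=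
  Sum.elim (fun a => y a) (fun _ => 0) (A.next t p.1 p.2)

theorem observed_succ (A : Algorithm Ω ι κ) (u : Ω) (ω : ℕ → ι → ℝ) (t : ℕ) :
    A.observed u ω (t + 1) = Fin.snoc (α := fun _ => ℝ) (A.observed u ω t)
      (A.pick t (u, A.observed u ω t) (ω t)) := rfl

open Classical in
theorem pick_eq_sum [Fintype ι] (A : Algorithm Ω ι κ) (t : ℕ) (p : Ω × (Fin t → ℝ)) (y : ι → ℝ) :
    A.pick t p y = ∑ a, if A.next t p.1 p.2 = Sum.inl a then y a else 0 := by
  unfold pick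
  cases h : A.next t p.1 p.2 with
  | inl b => simp
  | inr o => simp

theorem measurable_pick [Fintype ι] (A : Algorithm Ω ι κ) (t : ℕ) :
    Measurable fun z : (Ω × (Fin t → ℝ)) × (ι → ℝ) => A.pick t z.1 z.2 := by
  classical
  simp only [pick_eq_sum]
  refine Finset.measurable_sum _ fun a _ => Measurable.ite ?_ ?_ measurable_const
  · exact measurable_fst (A.measurable_next t (Sum.inl a))
  · exact (measurable_pi_apply a).comp measurable_snd

theorem measurable_snoc (t : ℕ) :
    Measurable fun z : (Fin t → ℝ) × ℝ =>
      (Fin.snoc (α := fun _ => ℝ) z.1 z.2 : Fin (t + 1) → ℝ) := by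
  refine measurable_pi_lambda _ fun i => ?_
  refine Fin.lastCases ?_ (fun j => ?_) i
  · simpa using measurable_snd
  · simp only [Fin.snoc_castSucc]
    exact (measurable_pi_apply j).comp measurable_fst

theorem measurable_observed [Fintype ι] (A : Algorithm Ω ι κ) (t : ℕ) :
    Measurable fun q : Ω × (ℕ → ι → ℝ) => A.observed q.1 q.2 t := by
  induction t with
  | zero => exact measurable_const
  | succ t ih =>
    simp only [observed_succ]
    refine (measurable_snoc t).comp (ih.prodMk ((A.measurable_pick t).comp
      ((measurable_fst.prodMk ih).prodMk ((measurable_pi_apply t).comp measurable_snd))))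

theorem measurable_history [Fintype ι] (A : Algorithm Ω ι κ) (t : ℕ) :
    Measurable fun q : Ω × (ℕ → ι → ℝ) => (q.1, A.observed q.1 q.2 t) :=
  measurable_fst.prodMk (A.measurable_observed t)

theorem measurableSet_next_observed [Fintype ι] (A : Algorithm Ω ι κ) (t : ℕ) (x : ι ⊕ (κ → ι)) :
    MeasurableSet {q : Ω × (ℕ → ι → ℝ) | A.next t q.1 (A.observed q.1 q.2 t) = x} :=
  A.measurable_history t (A.measurable_next t x)

theorem observed_congr (A : Algorithm Ω ι κ) (u : Ω) {ω ω' : ℕ → ι → ℝ} {t : ℕ}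
    (h : ∀ s < t, ω s = ω' s) : A.observed u ω t = A.observed u ω' t := by
  induction t with
  | zero => rfl
  | succ t ih =>
    simp only [observed]
    rw [ih fun s hs => h s (hs.trans t.lt_succ_self), h t t.lt_succ_self]

/-- The history before round `t` is independent of the samples of round `t`. -/
theorem indepFun_observed [Fintype ι] (A : Algorithm Ω ι κ) (ν : Arms ι) (u : Ω) (t : ℕ) :
    IndepFun (fun ω => A.observed u ω t) (fun ω => ω t)
      (Measure.infinitePi (fun _ : ℕ => Measure.pi ν.law)) := by
  have h := iIndepFun_infinitePi (P := fun _ : ℕ => Measure.pi ν.law)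
    (X := fun _ y => y) (fun _ => measurable_id)
  have h2 := h.indepFun_finset (Finset.range t) {t} (by simp) (fun i => measurable_pi_apply i)
  -- Rows from `t` on are filled with `0`; by `observed_congr` the history before round `t` does not
  -- see them.
  let ext : ((i : Finset.range t) → ι → ℝ) → ℕ → ι → ℝ :=
    fun r s => if hs : s ∈ Finset.range t then r ⟨s, hs⟩ else 0
  have hext : Measurable ext := by
    refine measurable_pi_lambda _ fun s => ?_
    by_cases hs : s ∈ Finset.range t
    · simp only [ext, hs, dite_true]
      exact measurable_pi_apply (⟨s, hs⟩ : Finset.range t)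
    · simp only [ext, hs, dite_false]
      exact measurable_const
  have hproj : Measurable fun r : ({t} : Finset ℕ) → ι → ℝ =>
      r ⟨t, Finset.mem_singleton_self t⟩ := measurable_pi_apply _
  have h3 := h2.comp (φ := fun r => A.observed u (ext r) t)
    (ψ := fun r => r ⟨t, Finset.mem_singleton_self t⟩)
    ((A.measurable_observed t).comp (measurable_prodMk_left.comp hext))
    hproj
  have hobs : (fun ω => A.observed u ω t) = (fun r => A.observed u (ext r) t) ∘
      fun (ω : ℕ → ι → ℝ) (i : Finset.range t) => ω i := by
    funext ω
    refine A.observed_congr u fun s hs => ?_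
    simp [ext, hs]
  rw [hobs]
  exact h3

/-- Conditionally on the history, row `t` is a fresh sample, so it can be integrated out first. This
drives every induction on the horizon. -/
theorem lintegral_history_row [Fintype ι] (A : Algorithm Ω ι κ) (Q : Measure Ω) [IsProbabilityMeasure Q]
    (ν : Arms ι) (t : ℕ) {F : (Ω × (Fin t → ℝ)) × (ι → ℝ) → ℝ≥0∞} (hF : Measurable F) :
    ∫⁻ q, F ((q.1, A.observed q.1 q.2 t), q.2 t) ∂(runLaw Q ν) =
      ∫⁻ q, ∫⁻ y, F ((q.1, A.observed q.1 q.2 t), y) ∂(Measure.pi ν.law) ∂(runLaw Q ν) := by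
  have hrow : Measurable fun q : Ω × (ℕ → ι → ℝ) => q.2 t :=
    (measurable_pi_apply t).comp measurable_snd
  unfold runLaw
  have hL := (hF.comp ((A.measurable_history t).prodMk hrow)).aemeasurable
    (μ := Q.prod (Measure.infinitePi (fun _ : ℕ => Measure.pi ν.law)))
  have hR := ((hF.lintegral_prod_right' (ν := Measure.pi ν.law)).comp
    (A.measurable_history t)).aemeasurable
    (μ := Q.prod (Measure.infinitePi (fun _ : ℕ => Measure.pi ν.law)))
  refine (lintegral_prod _ hL).trans (Eq.trans ?_ (lintegral_prod _ hR).symm)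
  refine lintegral_congr fun u => ?_
  have hX : Measurable fun ω => A.observed u ω t :=
    (A.measurable_observed t).comp measurable_prodMk_left
  have hY : Measurable fun ω : ℕ → ι → ℝ => ω t := measurable_pi_apply t
  have hmap := (indepFun_iff_map_prod_eq_prod_map_map hX.aemeasurable hY.aemeasurable).1
    (A.indepFun_observed ν u t)
  have hG : Measurable fun z : (Fin t → ℝ) × (ι → ℝ) => F ((u, z.1), z.2) :=
    hF.comp ((measurable_prodMk_left.comp measurable_fst).prodMk measurable_snd)
  have h1 := lintegral_map (μ := Measure.infinitePi (fun _ : ℕ => Measure.pi ν.law)) hG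
    (hX.prodMk hY)
  rw [hmap, lintegral_prod _ hG.aemeasurable, Measure.infinitePi_map_eval,
    lintegral_map hG.lintegral_prod_right' hX] at h1
  exact h1.symm

end Algorithm

/-! ### Bernoulli arms. -/

/-- The Bernoulli distribution with mean `w`, as a measure on `ℝ`. -/
noncomputable def bernoulliLaw (w : ℝ) : Measure ℝ :=
  ENNReal.ofReal w • Measure.dirac 1 + ENNReal.ofReal (1 - w) • Measure.dirac 0

theorem lintegral_bernoulliLaw (w : ℝ) (f : ℝ → ℝ≥0∞) :
    ∫⁻ x, f x ∂(bernoulliLaw w) = ENNReal.ofReal w * f 1 + ENNReal.ofReal (1 - w) * f 0 := by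
  simp [bernoulliLaw, lintegral_add_measure, lintegral_smul_measure]

theorem isProbabilityMeasure_bernoulliLaw {w : ℝ} (h0 : 0 ≤ w) (h1 : w ≤ 1) :
    IsProbabilityMeasure (bernoulliLaw w) := by
  constructor
  simp only [bernoulliLaw, Measure.add_apply, Measure.smul_apply, measure_univ, smul_eq_mul,
    mul_one]
  rw [← ENNReal.ofReal_add h0 (by linarith)]
  simp

theorem bernoulliLaw_compl_Icc (w : ℝ) : bernoulliLaw w (Set.Icc 0 1)ᶜ = 0 := by
  simp [bernoulliLaw, Measure.dirac_apply' _ measurableSet_Icc.compl]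

theorem integral_bernoulliLaw {w : ℝ} (h0 : 0 ≤ w) : ∫ x, x ∂(bernoulliLaw w) = w := by
  have hi (c : ℝ) (b : ℝ) : Integrable (fun x : ℝ => x) (ENNReal.ofReal c • Measure.dirac b) :=
    (integrable_dirac (by simp)).smul_measure ENNReal.ofReal_ne_top
  rw [bernoulliLaw, integral_add_measure (hi _ _) (hi _ _), integral_smul_measure,
    integral_smul_measure, integral_dirac, integral_dirac, ENNReal.toReal_ofReal h0]
  simp

/-- Arms with Bernoulli distributions. -/
noncomputable def bernoulliArms {ι : Type*} (W : ι → ℝ) (hW : ∀ a, 0 ≤ W a ∧ W a ≤ 1) : Arms ι where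
  law a := bernoulliLaw (W a)
  isProb a := isProbabilityMeasure_bernoulliLaw (hW a).1 (hW a).2
  support a := bernoulliLaw_compl_Icc (W a)

theorem weight_bernoulliArms {ι : Type*} (W : ι → ℝ) (hW : ∀ a, 0 ≤ W a ∧ W a ≤ 1) (a : ι) :
    (bernoulliArms W hW).weight a = W a :=
  integral_bernoulliLaw (hW a).1

/-! ### Likelihood ratios and change of measure. -/

namespace Algorithm

variable {Ω ι κ : Type*} [MeasurableSpace Ω]

theorem measurable_init (t : ℕ) :
    Measurable fun h : Fin (t + 1) → ℝ => (Fin.init (α := fun _ => ℝ) h : Fin t → ℝ) :=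
  measurable_pi_lambda _ fun i => measurable_pi_apply i.castSucc

open Classical in
/-- The increment of the log-likelihood ratio in round `t` when the value `z` is observed;
`l₁` and `l₀` are the log-likelihood ratios of the outcomes `1` and `0` of arm `a`. -/
noncomputable def logRatioStep (A : Algorithm Ω ι κ) (a : ι) (l₁ l₀ : ℝ) (t : ℕ)
    (p : Ω × (Fin t → ℝ)) (z : ℝ) : ℝ :=
  if A.next t p.1 p.2 = Sum.inl a then if z = 1 then l₁ else l₀ else 0

/-- The log-likelihood ratio of a history. -/
noncomputable def logRatio (A : Algorithm Ω ι κ) (a : ι) (l₁ l₀ : ℝ) :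
    (t : ℕ) → Ω × (Fin t → ℝ) → ℝ
  | 0, _ => 0
  | t + 1, p => A.logRatio a l₁ l₀ t (p.1, Fin.init p.2) +
      A.logRatioStep a l₁ l₀ t (p.1, Fin.init p.2) (p.2 (Fin.last t))

theorem measurable_logRatioStep (A : Algorithm Ω ι κ) (a : ι) (l₁ l₀ : ℝ) (t : ℕ) :
    Measurable fun r : (Ω × (Fin t → ℝ)) × ℝ => A.logRatioStep a l₁ l₀ t r.1 r.2 := by
  unfold logRatioStep
  refine Measurable.ite (measurable_fst (A.measurable_next t (Sum.inl a))) ?_ measurable_const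
  exact Measurable.ite (measurable_snd (measurableSet_singleton 1)) measurable_const
    measurable_const

theorem measurable_logRatio (A : Algorithm Ω ι κ) (a : ι) (l₁ l₀ : ℝ) (t : ℕ) :
    Measurable (A.logRatio a l₁ l₀ t) := by
  induction t with
  | zero => exact measurable_const
  | succ t ih =>
    have hi : Measurable fun p : Ω × (Fin (t + 1) → ℝ) =>
        (p.1, (Fin.init (α := fun _ => ℝ) p.2 : Fin t → ℝ)) :=
      measurable_fst.prodMk ((measurable_init t).comp measurable_snd)
    exact (ih.comp hi).add ((A.measurable_logRatioStep a l₁ l₀ t).comp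
      (hi.prodMk ((measurable_pi_apply (Fin.last t)).comp measurable_snd)))

theorem logRatio_snoc (A : Algorithm Ω ι κ) (a : ι) (l₁ l₀ : ℝ) (t : ℕ) (u : Ω) (h : Fin t → ℝ)
    (z : ℝ) : A.logRatio a l₁ l₀ (t + 1) (u, Fin.snoc (α := fun _ => ℝ) h z) =
      A.logRatio a l₁ l₀ t (u, h) + A.logRatioStep a l₁ l₀ t (u, h) z := by
  simp [logRatio]

/-- One round of the change of measure: if arm `a` is sampled, the Bernoulli laws have density `w' /
w` at `1` and `(1 - w') / (1 - w)` at `0`; otherwise the recorded value has the same law under both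
instances. -/
theorem lintegral_pick_changeOfMeasure [Fintype ι] (A : Algorithm Ω ι κ) {ν ν' : Arms ι} {a : ι}
    (hne : ∀ b, b ≠ a → ν'.law b = ν.law b) {w w' : ℝ} (hw : ν.law a = bernoulliLaw w)
    (hw' : ν'.law a = bernoulliLaw w') (h0 : 0 < w) (h1 : w < 1) (h0' : 0 < w') (h1' : w' < 1)
    (t : ℕ) (p : Ω × (Fin t → ℝ)) {g : ℝ → ℝ≥0∞} (hg : Measurable g) :
    ∫⁻ y, g (A.pick t p y) ∂(Measure.pi ν'.law) =
      ∫⁻ y, g (A.pick t p y) * ENNReal.ofReal (Real.exp (A.logRatioStep a (Real.log (w' / w))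
        (Real.log ((1 - w') / (1 - w))) t p (A.pick t p y))) ∂(Measure.pi ν.law) := by
  have heval (μ : Arms ι) (b : ι) {f : ℝ → ℝ≥0∞} (hf : Measurable f) :
      ∫⁻ y, f (y b) ∂(Measure.pi μ.law) = ∫⁻ x, f x ∂(μ.law b) :=
    (measurePreserving_eval μ.law b).lintegral_comp hf
  unfold pick logRatioStep
  cases hx : A.next t p.1 p.2 with
  | inr o => simp
  | inl b =>
    by_cases hb : b = a
    · subst hb
      simp only [Sum.elim_inl, if_true]
      have hr := heval ν b (f := fun z => g z * ENNReal.ofReal (Real.exp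
        (if z = 1 then Real.log (w' / w) else Real.log ((1 - w') / (1 - w)))))
        (hg.mul (ENNReal.measurable_ofReal.comp (Real.measurable_exp.comp
          (Measurable.ite (measurableSet_singleton 1) measurable_const measurable_const))))
      refine (heval ν' b hg).trans (Eq.trans ?_ hr.symm)
      rw [hw, hw', lintegral_bernoulliLaw, lintegral_bernoulliLaw]
      have e1 : 0 < w' / w := div_pos h0' h0
      have e0 : 0 < (1 - w') / (1 - w) := div_pos (by linarith) (by linarith)
      simp only [if_true, zero_ne_one, if_false, Real.exp_log e1, Real.exp_log e0]
      have k1 : ENNReal.ofReal w' = ENNReal.ofReal w * ENNReal.ofReal (w' / w) := by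
        rw [← ENNReal.ofReal_mul h0.le, mul_div_cancel₀ _ h0.ne']
      have k0 : ENNReal.ofReal (1 - w') =
          ENNReal.ofReal (1 - w) * ENNReal.ofReal ((1 - w') / (1 - w)) := by
        rw [← ENNReal.ofReal_mul (by linarith), mul_div_cancel₀ _ (by linarith)]
      rw [k1, k0]
      ring
    · have hb' : (Sum.inl b : ι ⊕ (κ → ι)) ≠ Sum.inl a := fun h => hb (Sum.inl.inj h)
      simp only [Sum.elim_inl, hb', if_false, Real.exp_zero, ENNReal.ofReal_one, mul_one]
      rw [heval ν' b hg, heval ν b hg, hne b hb]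

/-- Change of measure for functions of the history. -/
theorem lintegral_changeOfMeasure [Fintype ι] (A : Algorithm Ω ι κ) (Q : Measure Ω)
    [IsProbabilityMeasure Q] {ν ν' : Arms ι} {a : ι}
    (hne : ∀ b, b ≠ a → ν'.law b = ν.law b) {w w' : ℝ} (hw : ν.law a = bernoulliLaw w)
    (hw' : ν'.law a = bernoulliLaw w') (h0 : 0 < w) (h1 : w < 1) (h0' : 0 < w') (h1' : w' < 1)
    (t : ℕ) {f : Ω × (Fin t → ℝ) → ℝ≥0∞} (hf : Measurable f) :
    ∫⁻ q, f (q.1, A.observed q.1 q.2 t) ∂(runLaw Q ν') =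
      ∫⁻ q, f (q.1, A.observed q.1 q.2 t) * ENNReal.ofReal (Real.exp (A.logRatio a
        (Real.log (w' / w)) (Real.log ((1 - w') / (1 - w))) t (q.1, A.observed q.1 q.2 t)))
        ∂(runLaw Q ν) := by
  set l₁ := Real.log (w' / w) with hl₁
  set l₀ := Real.log ((1 - w') / (1 - w)) with hl₀
  induction t with
  | zero =>
    simp only [logRatio, Real.exp_zero, ENNReal.ofReal_one, mul_one, observed]
    have hf' : Measurable fun u : Ω => f (u, Fin.elim0) := hf.comp measurable_prodMk_right
    unfold runLaw
    rw [measurePreserving_fst.lintegral_comp hf', measurePreserving_fst.lintegral_comp hf']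
  | succ t ih =>
    have hS : Measurable fun r : (Ω × (Fin t → ℝ)) × ℝ =>
        (r.1.1, (Fin.snoc (α := fun _ => ℝ) r.1.2 r.2 : Fin (t + 1) → ℝ)) :=
      (measurable_fst.comp measurable_fst).prodMk ((measurable_snoc t).comp
        ((measurable_snd.comp measurable_fst).prodMk measurable_snd))
    have hP : Measurable fun r : (Ω × (Fin t → ℝ)) × (ι → ℝ) => (r.1, A.pick t r.1 r.2) :=
      measurable_fst.prodMk (A.measurable_pick t)
    have hE : Measurable fun r : (Ω × (Fin t → ℝ)) × ℝ =>
        ENNReal.ofReal (Real.exp (A.logRatioStep a l₁ l₀ t r.1 r.2)) :=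
      ENNReal.measurable_ofReal.comp (Real.measurable_exp.comp (A.measurable_logRatioStep a _ _ t))
    have hL : Measurable fun p : Ω × (Fin t → ℝ) =>
        ENNReal.ofReal (Real.exp (A.logRatio a l₁ l₀ t p)) :=
      ENNReal.measurable_ofReal.comp (Real.measurable_exp.comp (A.measurable_logRatio a _ _ t))
    have hfS := hf.comp hS
    simp only [observed_succ, logRatio_snoc, Real.exp_add,
      ENNReal.ofReal_mul (Real.exp_pos _).le]
    -- Row `t` is integrated out on both sides; the induction hypothesis then changes the law of the
    -- first `t` rounds, leaving only the one-round identity.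
    rw [A.lintegral_history_row Q ν' t (F := fun r => f (r.1.1, Fin.snoc (α := fun _ => ℝ) r.1.2
        (A.pick t r.1 r.2))) (hfS.comp hP),
      A.lintegral_history_row Q ν t (F := fun r => f (r.1.1, Fin.snoc (α := fun _ => ℝ) r.1.2
        (A.pick t r.1 r.2)) * (ENNReal.ofReal (Real.exp (A.logRatio a l₁ l₀ t (r.1.1, r.1.2))) *
        ENNReal.ofReal (Real.exp (A.logRatioStep a l₁ l₀ t (r.1.1, r.1.2) (A.pick t r.1 r.2)))))
        ((hfS.comp hP).mul ((hL.comp measurable_fst).mul (hE.comp hP))),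
      ih (f := fun p => ∫⁻ y, f (p.1, Fin.snoc (α := fun _ => ℝ) p.2
        (A.pick t p y)) ∂(Measure.pi ν'.law)) (hfS.comp hP).lintegral_prod_right']
    refine lintegral_congr fun q => ?_
    have hq : Measurable fun z : ℝ =>
        f (q.1, Fin.snoc (α := fun _ => ℝ) (A.observed q.1 q.2 t) z) :=
      hfS.comp (measurable_prodMk_left (x := (q.1, A.observed q.1 q.2 t)))
    have h := A.lintegral_pick_changeOfMeasure hne hw hw' h0 h1 h0' h1' t
      (q.1, A.observed q.1 q.2 t) hq
    dsimp only at h ⊢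
    rw [h, ← lintegral_mul_const']
    · refine lintegral_congr fun y => ?_
      ring
    · exact ENNReal.ofReal_ne_top

end Algorithm

/-! ### Expected log-likelihood ratio and transportation at a fixed horizon. -/

theorem integral_bernoulliLaw_comp {w : ℝ} (h0 : 0 ≤ w) (h1 : w ≤ 1) (g : ℝ → ℝ) :
    ∫ x, g x ∂(bernoulliLaw w) = w * g 1 + (1 - w) * g 0 := by
  have hi (c : ℝ) (b : ℝ) : Integrable g (ENNReal.ofReal c • Measure.dirac b) :=
    (integrable_dirac (by simp)).smul_measure ENNReal.ofReal_ne_top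
  rw [bernoulliLaw, integral_add_measure (hi _ _) (hi _ _), integral_smul_measure,
    integral_smul_measure, integral_dirac, integral_dirac, ENNReal.toReal_ofReal h0,
    ENNReal.toReal_ofReal (by linarith)]
  simp

namespace Algorithm

variable {Ω ι κ : Type*} [MeasurableSpace Ω]

theorem map_history_row [Fintype ι] (A : Algorithm Ω ι κ) (Q : Measure Ω) [IsProbabilityMeasure Q]
    (ν : Arms ι) (t : ℕ) :
    (runLaw Q ν).map (fun q => ((q.1, A.observed q.1 q.2 t), q.2 t)) =
      ((runLaw Q ν).map (fun q => (q.1, A.observed q.1 q.2 t))).prod (Measure.pi ν.law) := by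
  have hrow : Measurable fun q : Ω × (ℕ → ι → ℝ) => q.2 t :=
    (measurable_pi_apply t).comp measurable_snd
  have : IsProbabilityMeasure ((runLaw Q ν).map (fun q => (q.1, A.observed q.1 q.2 t))) :=
    Measure.isProbabilityMeasure_map (A.measurable_history t).aemeasurable
  refine Measure.ext_of_lintegral _ fun F hF => ?_
  rw [lintegral_map hF ((A.measurable_history t).prodMk hrow), lintegral_prod _ hF.aemeasurable,
    lintegral_map hF.lintegral_prod_right' (A.measurable_history t)]
  exact A.lintegral_history_row Q ν t hF

theorem abs_logRatioStep_le (A : Algorithm Ω ι κ) (a : ι) (l₁ l₀ : ℝ) (t : ℕ)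
    (p : Ω × (Fin t → ℝ)) (z : ℝ) : |A.logRatioStep a l₁ l₀ t p z| ≤ |l₁| + |l₀| := by
  unfold logRatioStep
  have := abs_nonneg l₁
  have := abs_nonneg l₀
  split_ifs
  · linarith
  · linarith
  · simp only [abs_zero]; linarith

theorem abs_logRatio_le (A : Algorithm Ω ι κ) (a : ι) (l₁ l₀ : ℝ) (t : ℕ)
    (p : Ω × (Fin t → ℝ)) : |A.logRatio a l₁ l₀ t p| ≤ t * (|l₁| + |l₀|) := by
  induction t with
  | zero => simp [logRatio]
  | succ t ih =>
    rw [logRatio]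
    refine (abs_add_le _ _).trans ?_
    push_cast
    have := ih (p.1, Fin.init p.2)
    have := A.abs_logRatioStep_le a l₁ l₀ t (p.1, Fin.init p.2) (p.2 (Fin.last t))
    linarith

theorem integrable_logRatio [Fintype ι] (A : Algorithm Ω ι κ) (Q : Measure Ω)
    [IsProbabilityMeasure Q] (ν : Arms ι) (a : ι) (l₁ l₀ : ℝ) (t : ℕ) :
    Integrable (fun q => A.logRatio a l₁ l₀ t (q.1, A.observed q.1 q.2 t)) (runLaw Q ν) :=
  Integrable.of_bound ((A.measurable_logRatio a l₁ l₀ t).comp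
    (A.measurable_history t)).aestronglyMeasurable _
    (Filter.Eventually.of_forall fun _ => A.abs_logRatio_le a l₁ l₀ t _)

theorem integrable_exp_logRatio [Fintype ι] (A : Algorithm Ω ι κ) (Q : Measure Ω)
    [IsProbabilityMeasure Q] (ν : Arms ι) (a : ι) (l₁ l₀ : ℝ) (t : ℕ) :
    Integrable (fun q => Real.exp (A.logRatio a l₁ l₀ t (q.1, A.observed q.1 q.2 t)))
      (runLaw Q ν) := by
  refine Integrable.of_bound (Real.measurable_exp.comp ((A.measurable_logRatio a l₁ l₀ t).comp
    (A.measurable_history t))).aestronglyMeasurable (Real.exp (t * (|l₁| + |l₀|)))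
    (Filter.Eventually.of_forall fun q => ?_)
  rw [Real.norm_eq_abs, Real.abs_exp]
  exact Real.exp_le_exp.2 ((le_abs_self _).trans (A.abs_logRatio_le a l₁ l₀ t _))

theorem integral_logRatioStep [Fintype ι] (A : Algorithm Ω ι κ) (Q : Measure Ω)
    [IsProbabilityMeasure Q] {ν : Arms ι} {a : ι} {w : ℝ} (hw : ν.law a = bernoulliLaw w)
    (h0 : 0 ≤ w) (h1 : w ≤ 1) (l₁ l₀ : ℝ) (t : ℕ) :
    ∫ q, A.logRatioStep a l₁ l₀ t (q.1, A.observed q.1 q.2 t)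
        (A.pick t (q.1, A.observed q.1 q.2 t) (q.2 t)) ∂(runLaw Q ν) =
      (w * l₁ + (1 - w) * l₀) *
        (runLaw Q ν).real {q | A.next t q.1 (A.observed q.1 q.2 t) = Sum.inl a} := by
  have hrow : Measurable fun q : Ω × (ℕ → ι → ℝ) => q.2 t :=
    (measurable_pi_apply t).comp measurable_snd
  have hprob : IsProbabilityMeasure ((runLaw Q ν).map (fun q => (q.1, A.observed q.1 q.2 t))) :=
    Measure.isProbabilityMeasure_map (A.measurable_history t).aemeasurable
  set F : (Ω × (Fin t → ℝ)) × (ι → ℝ) → ℝ :=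
    fun r => A.logRatioStep a l₁ l₀ t r.1 (A.pick t r.1 r.2) with hFdef
  have hF : Measurable F := (A.measurable_logRatioStep a l₁ l₀ t).comp
    (measurable_fst.prodMk (A.measurable_pick t))
  have hFi : Integrable F (((runLaw Q ν).map (fun q => (q.1, A.observed q.1 q.2 t))).prod
      (Measure.pi ν.law)) :=
    Integrable.of_bound hF.aestronglyMeasurable _
      (Filter.Eventually.of_forall fun _ => A.abs_logRatioStep_le a l₁ l₀ t _ _)
  have e1 := integral_map (μ := runLaw Q ν) ((A.measurable_history t).prodMk hrow).aemeasurable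
    hF.aestronglyMeasurable
  rw [A.map_history_row, integral_prod _ hFi, integral_map (A.measurable_history t).aemeasurable
    hFi.integral_prod_left.aestronglyMeasurable] at e1
  refine e1.symm.trans ?_
  rw [mul_comm, ← smul_eq_mul, ← integral_indicator_const _ (A.measurableSet_next_observed t _)]
  refine integral_congr_ae (Filter.Eventually.of_forall fun q => ?_)
  simp only [hFdef, pick, logRatioStep]
  by_cases hx : A.next t q.1 (A.observed q.1 q.2 t) = Sum.inl a
  · simp only [hx, if_true, Sum.elim_inl]
    have hg : Measurable fun z : ℝ => if z = 1 then l₁ else l₀ :=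
      Measurable.ite (measurableSet_singleton 1) measurable_const measurable_const
    have e2 := integral_map (μ := Measure.pi ν.law) (measurable_pi_apply a).aemeasurable
      hg.aestronglyMeasurable
    rw [(measurePreserving_eval ν.law a).map_eq, hw, integral_bernoulliLaw_comp h0 h1] at e2
    refine e2.symm.trans ?_
    refine Eq.trans ?_ (Set.indicator_of_mem
      (s := {q : Ω × (ℕ → ι → ℝ) | A.next t q.1 (A.observed q.1 q.2 t) = Sum.inl a}) hx _).symm
    simp
  · refine Eq.trans ?_ (Set.indicator_of_notMem
      (s := {q : Ω × (ℕ → ι → ℝ) | A.next t q.1 (A.observed q.1 q.2 t) = Sum.inl a}) hx _).symm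
    simp only [hx, if_false, integral_zero]

/-- Wald's identity at a deterministic horizon: each sample of arm `a` contributes the same
conditional mean, and the other rounds contribute nothing. -/
theorem integral_logRatio [Fintype ι] (A : Algorithm Ω ι κ) (Q : Measure Ω)
    [IsProbabilityMeasure Q] {ν : Arms ι} {a : ι} {w : ℝ} (hw : ν.law a = bernoulliLaw w)
    (h0 : 0 ≤ w) (h1 : w ≤ 1) (l₁ l₀ : ℝ) (t : ℕ) :
    ∫ q, A.logRatio a l₁ l₀ t (q.1, A.observed q.1 q.2 t) ∂(runLaw Q ν) =
      (w * l₁ + (1 - w) * l₀) * ∑ s ∈ Finset.range t,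
        (runLaw Q ν).real {q | A.next s q.1 (A.observed q.1 q.2 s) = Sum.inl a} := by
  induction t with
  | zero => simp [logRatio]
  | succ t ih =>
    have hrow : Measurable fun q : Ω × (ℕ → ι → ℝ) => q.2 t :=
      (measurable_pi_apply t).comp measurable_snd
    have hi : Integrable (fun q : Ω × (ℕ → ι → ℝ) =>
        A.logRatioStep a l₁ l₀ t (q.1, A.observed q.1 q.2 t)
        (A.pick t (q.1, A.observed q.1 q.2 t) (q.2 t))) (runLaw Q ν) :=
      Integrable.of_bound ((A.measurable_logRatioStep a l₁ l₀ t).comp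
        ((A.measurable_history t).prodMk ((A.measurable_pick t).comp
        ((A.measurable_history t).prodMk hrow)))).aestronglyMeasurable _
        (Filter.Eventually.of_forall fun _ => A.abs_logRatioStep_le a l₁ l₀ t _ _)
    simp only [observed_succ, logRatio_snoc]
    rw [integral_add (A.integrable_logRatio Q ν a l₁ l₀ t) hi, ih,
      A.integral_logRatioStep Q hw h0 h1, Finset.sum_range_succ, mul_add]

theorem measureReal_changeOfMeasure [Fintype ι] (A : Algorithm Ω ι κ) (Q : Measure Ω)
    [IsProbabilityMeasure Q] {ν ν' : Arms ι} {a : ι}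
    (hne : ∀ b, b ≠ a → ν'.law b = ν.law b) {w w' : ℝ} (hw : ν.law a = bernoulliLaw w)
    (hw' : ν'.law a = bernoulliLaw w') (h0 : 0 < w) (h1 : w < 1) (h0' : 0 < w') (h1' : w' < 1)
    (t : ℕ) {D : Set (Ω × (Fin t → ℝ))} (hD : MeasurableSet D) :
    (runLaw Q ν').real {q | (q.1, A.observed q.1 q.2 t) ∈ D} =
      ∫ q, {q : Ω × (ℕ → ι → ℝ) | (q.1, A.observed q.1 q.2 t) ∈ D}.indicator
        (fun q => Real.exp (A.logRatio a (Real.log (w' / w)) (Real.log ((1 - w') / (1 - w))) t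
          (q.1, A.observed q.1 q.2 t))) q ∂(runLaw Q ν) := by
  have hE : MeasurableSet {q : Ω × (ℕ → ι → ℝ) | (q.1, A.observed q.1 q.2 t) ∈ D} :=
    A.measurable_history t hD
  have h := A.lintegral_changeOfMeasure Q hne hw hw' h0 h1 h0' h1' t
    (f := D.indicator 1) (measurable_one.indicator hD)
  rw [integral_eq_lintegral_of_nonneg_ae
    (Filter.Eventually.of_forall fun q => Set.indicator_nonneg (fun _ _ => (Real.exp_pos _).le) q)
    ((A.integrable_exp_logRatio Q ν a _ _ t).indicator hE).aestronglyMeasurable, measureReal_def]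
  congr 1
  rw [← lintegral_indicator_one hE]
  refine Eq.trans ?_ (h.trans ?_)
  · rfl
  · refine lintegral_congr fun q => ?_
    by_cases hq : (q.1, A.observed q.1 q.2 t) ∈ D <;> simp [hq]

/-- A transportation inequality between two instances that differ in one arm, for events
determined by the first `t` rounds. -/
theorem transportation_horizon [Fintype ι] (A : Algorithm Ω ι κ) (Q : Measure Ω)
    [IsProbabilityMeasure Q] {ν ν' : Arms ι} {a : ι}
    (hne : ∀ b, b ≠ a → ν'.law b = ν.law b) {w w' : ℝ} (hw : ν.law a = bernoulliLaw w)
    (hw' : ν'.law a = bernoulliLaw w') (h0 : 0 < w) (h1 : w < 1) (h0' : 0 < w') (h1' : w' < 1)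
    (t : ℕ) {D : Set (Ω × (Fin t → ℝ))} (hD : MeasurableSet D) (l : ℝ) :
    l * (runLaw Q ν).real {q | (q.1, A.observed q.1 q.2 t) ∈ D} ≤
      (Real.exp l - 1) * (runLaw Q ν').real {q | (q.1, A.observed q.1 q.2 t) ∈ D} +
      (w - w') ^ 2 / (w' * (1 - w')) * ∑ s ∈ Finset.range t,
        (runLaw Q ν).real {q | A.next s q.1 (A.observed q.1 q.2 s) = Sum.inl a} := by
  set l₁ := Real.log (w' / w) with hl₁
  set l₀ := Real.log ((1 - w') / (1 - w)) with hl₀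
  set E := {q : Ω × (ℕ → ι → ℝ) | (q.1, A.observed q.1 q.2 t) ∈ D} with hEdef
  have hE : MeasurableSet E := A.measurable_history t hD
  set L : Ω × (ℕ → ι → ℝ) → ℝ := fun q => A.logRatio a l₁ l₀ t (q.1, A.observed q.1 q.2 t)
    with hLdef
  set S := ∑ s ∈ Finset.range t,
        (runLaw Q ν).real {q | A.next s q.1 (A.observed q.1 q.2 s) = Sum.inl a} with hSdef
  have hS : 0 ≤ S := Finset.sum_nonneg fun _ _ => measureReal_nonneg
  have hLi : Integrable L (runLaw Q ν) := A.integrable_logRatio Q ν a l₁ l₀ t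
  have hexp : Integrable (fun q => Real.exp (L q)) (runLaw Q ν) :=
    A.integrable_exp_logRatio Q ν a l₁ l₀ t
  have e1 : (runLaw Q ν').real E = ∫ q, E.indicator (fun q => Real.exp (L q)) q ∂(runLaw Q ν) :=
    A.measureReal_changeOfMeasure Q hne hw hw' h0 h1 h0' h1' t hD
  -- The change of measure for the sure event: the likelihood ratio has mean `1`.
  have e2 : (1 : ℝ) = ∫ q, Real.exp (L q) ∂(runLaw Q ν) := by
    have := A.measureReal_changeOfMeasure Q hne hw hw' h0 h1 h0' h1' t MeasurableSet.univ
    simpa using this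
  have e3 : ∫ q, L q ∂(runLaw Q ν) = (w * l₁ + (1 - w) * l₀) * S :=
    A.integral_logRatio Q hw h0.le h1.le l₁ l₀ t
  -- The Kullback–Leibler divergence is at most the χ² divergence, by `log x ≤ x - 1` at both
  -- outcomes.
  have hkl : -(w * l₁ + (1 - w) * l₀) ≤ (w - w') ^ 2 / (w' * (1 - w')) := by
    have k1 : -l₁ ≤ w / w' - 1 := by
      rw [hl₁, ← Real.log_inv, inv_div]
      exact Real.log_le_sub_one_of_pos (div_pos h0 h0')
    have k0 : -l₀ ≤ (1 - w) / (1 - w') - 1 := by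
      rw [hl₀, ← Real.log_inv, inv_div]
      exact Real.log_le_sub_one_of_pos (div_pos (by linarith) (by linarith))
    have k2 : (w - w') ^ 2 / (w' * (1 - w')) =
        w * (w / w' - 1) + (1 - w) * ((1 - w) / (1 - w') - 1) := by
      have : 1 - w' ≠ 0 := by linarith
      field_simp
      ring
    rw [k2]
    nlinarith [mul_le_mul_of_nonneg_left k1 h0.le,
      mul_le_mul_of_nonneg_left k0 (by linarith : 0 ≤ 1 - w)]
  -- The inequality `x + 1 ≤ exp x`, at `x = l + L` on `E` and at `x = L` off `E`. Integrating it
  -- gives the claim: `exp L` turns `E` into its probability under `ν'`.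
  have hpt : ∀ q, E.indicator (fun _ => l) q + 1 + L q ≤
      (Real.exp l - 1) * E.indicator (fun q => Real.exp (L q)) q + Real.exp (L q) := by
    intro q
    by_cases hq : q ∈ E
    · simp only [Set.indicator_of_mem hq]
      have := Real.add_one_le_exp (l + L q)
      rw [Real.exp_add] at this
      linarith
    · simp only [Set.indicator_of_notMem hq]
      have := Real.add_one_le_exp (L q)
      linarith
  have hc : Integrable (E.indicator fun _ => l) (runLaw Q ν) := (integrable_const l).indicator hE
  have hi := integral_mono (μ := runLaw Q ν)
    (f := fun q => E.indicator (fun _ => l) q + 1 + L q)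
    (g := fun q => (Real.exp l - 1) * E.indicator (fun q => Real.exp (L q)) q + Real.exp (L q))
    ((hc.add (integrable_const 1)).add hLi) (((hexp.indicator hE).const_mul _).add hexp) hpt
  rw [integral_add (f := fun q => E.indicator (fun _ => l) q + 1) (hc.add (integrable_const 1)) hLi,
    integral_add hc (integrable_const 1),
    integral_add ((hexp.indicator hE).const_mul _) hexp, integral_const_mul, ← e1, ← e2, e3,
    integral_indicator_const _ hE] at hi
  simp only [smul_eq_mul, integral_const, probReal_univ, mul_one] at hi
  nlinarith [mul_le_mul_of_nonneg_right hkl hS]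

/-! ### Stopping, sample counts and transportation without a horizon. -/

/-- The rule that follows `A` but never resumes sampling after a stop. -/
def freezeNext (A : Algorithm Ω ι κ) : (t : ℕ) → Ω → (Fin t → ℝ) → ι ⊕ (κ → ι)
  | 0, u, h => A.next 0 u h
  | t + 1, u, h => Sum.elim (fun _ => A.next (t + 1) u h) Sum.inr
      (A.freezeNext t u (Fin.init (α := fun _ => ℝ) h))

theorem measurable_freezeNext [Finite ι] [Finite κ] (A : Algorithm Ω ι κ) (t : ℕ)
    (x : ι ⊕ (κ → ι)) :
    MeasurableSet {q : Ω × (Fin t → ℝ) | A.freezeNext t q.1 q.2 = x} := by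
  induction t generalizing x with
  | zero => exact A.measurable_next 0 x
  | succ t ih =>
    have hi : Measurable fun p : Ω × (Fin (t + 1) → ℝ) =>
        (p.1, (Fin.init (α := fun _ => ℝ) p.2 : Fin t → ℝ)) :=
      measurable_fst.prodMk ((measurable_init t).comp measurable_snd)
    have h : {q : Ω × (Fin (t + 1) → ℝ) | A.freezeNext (t + 1) q.1 q.2 = x} =
        ⋃ y : ι ⊕ (κ → ι),
          ((fun p : Ω × (Fin (t + 1) → ℝ) => (p.1, (Fin.init (α := fun _ => ℝ) p.2 : Fin t → ℝ))) ⁻¹'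
            {q | A.freezeNext t q.1 q.2 = y}) ∩
          {q | Sum.elim (fun _ => A.next (t + 1) q.1 q.2) Sum.inr y = x} := by
      ext q
      simp [freezeNext]
    rw [h]
    refine MeasurableSet.iUnion fun y => (hi (ih y)).inter ?_
    cases y with
    | inl a => exact A.measurable_next (t + 1) x
    | inr o =>
      simp only [Sum.elim_inr]
      exact MeasurableSet.const _

/-- The algorithm that follows `A` but never resumes sampling after a stop. -/
def freeze [Finite ι] [Finite κ] (A : Algorithm Ω ι κ) : Algorithm Ω ι κ where
  next := A.freezeNext
  measurable_next := A.measurable_freezeNext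

theorem freeze_next_succ [Finite ι] [Finite κ] (A : Algorithm Ω ι κ) (u : Ω) (ω : ℕ → ι → ℝ)
    (n : ℕ) : A.freeze.next (n + 1) u (A.freeze.observed u ω (n + 1)) =
      Sum.elim (fun _ => A.next (n + 1) u (A.freeze.observed u ω (n + 1))) Sum.inr
        (A.freeze.next n u (A.freeze.observed u ω n)) := by
  change A.freezeNext (n + 1) u _ = Sum.elim _ _ (A.freezeNext n u _)
  rw [freezeNext, observed_succ, Fin.init_snoc]

theorem stopsWith_unique (A : Algorithm Ω ι κ) {u : Ω} {ω : ℕ → ι → ℝ} {t t' : ℕ}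
    {o o' : κ → ι} (h : A.StopsWith u ω t o) (h' : A.StopsWith u ω t' o') : t = t' ∧ o = o' := by
  rcases lt_trichotomy t t' with hlt | rfl | hlt
  · obtain ⟨a, ha⟩ := h'.1 t hlt
    simp [h.2] at ha
  · exact ⟨rfl, Sum.inr.inj (h.2.symm.trans h'.2)⟩
  · obtain ⟨a, ha⟩ := h.1 t' hlt
    simp [h'.2] at ha

theorem freeze_cases [Finite ι] [Finite κ] (A : Algorithm Ω ι κ) (u : Ω) (ω : ℕ → ι → ℝ) (n : ℕ) :
    ((∀ s < n, ∃ a, A.next s u (A.observed u ω s) = Sum.inl a) ∧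
      A.freeze.observed u ω n = A.observed u ω n ∧
      A.freeze.next n u (A.freeze.observed u ω n) = A.next n u (A.observed u ω n)) ∨
    ∃ t < n, ∃ o, A.StopsWith u ω t o ∧
      A.freeze.next n u (A.freeze.observed u ω n) = Sum.inr o := by
  induction n with
  | zero => exact Or.inl ⟨by simp, rfl, rfl⟩
  | succ n ih =>
    rcases ih with ⟨h1, h2, h3⟩ | ⟨t, ht, o, hs, ho⟩
    · cases hx : A.next n u (A.observed u ω n) with
      | inl a =>
        have hobs : A.freeze.observed u ω (n + 1) = A.observed u ω (n + 1) := by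
          rw [observed, observed, h3, h2]
        refine Or.inl ⟨fun s hs => ?_, hobs, ?_⟩
        · rcases Nat.lt_succ_iff_lt_or_eq.1 hs with h | rfl
          · exact h1 s h
          · exact ⟨a, hx⟩
        · rw [freeze_next_succ, h3, hx, hobs]
          rfl
      | inr o =>
        refine Or.inr ⟨n, n.lt_succ_self, o, ⟨h1, hx⟩, ?_⟩
        rw [freeze_next_succ, h3, hx]
        rfl
    · refine Or.inr ⟨t, ht.trans n.lt_succ_self, o, hs, ?_⟩
      rw [freeze_next_succ, ho]
      rfl

/-- The decision rule may ask for samples again on histories recorded after a stop. Freezing makes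
the fact and content of an earlier report readable from the history at time `n`, as the
fixed-horizon inequality requires. -/
theorem freeze_next_eq_inr_iff [Finite ι] [Finite κ] (A : Algorithm Ω ι κ) (u : Ω)
    (ω : ℕ → ι → ℝ) (n : ℕ) (o : κ → ι) :
    A.freeze.next n u (A.freeze.observed u ω n) = Sum.inr o ↔ ∃ t ≤ n, A.StopsWith u ω t o := by
  rcases A.freeze_cases u ω n with ⟨h1, -, h3⟩ | ⟨t, ht, o', hs, ho⟩
  · rw [h3]
    refine ⟨fun h => ⟨n, le_rfl, h1, h⟩, ?_⟩
    rintro ⟨t, ht, hs⟩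
    rcases ht.lt_or_eq with hlt | rfl
    · obtain ⟨a, ha⟩ := h1 t hlt
      simp [hs.2] at ha
    · exact hs.2
  · rw [ho]
    refine ⟨fun h => ⟨t, ht.le, Sum.inr.inj h ▸ hs⟩, ?_⟩
    rintro ⟨t', -, hs'⟩
    rw [(A.stopsWith_unique hs hs').2]

/-- The event that the algorithm stops and its report satisfies `P`. -/
def stopEvent (A : Algorithm Ω ι κ) (P : (κ → ι) → Prop) : Set (Ω × (ℕ → ι → ℝ)) :=
  {q | ∃ t out, A.StopsWith q.1 q.2 t out ∧ P out}

/-- The event that the algorithm stops within `n` rounds and its report satisfies `P`. -/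
def stopEventBefore [Finite ι] [Finite κ] (A : Algorithm Ω ι κ) (P : (κ → ι) → Prop) (n : ℕ) :
    Set (Ω × (ℕ → ι → ℝ)) :=
  {q | (q.1, A.freeze.observed q.1 q.2 n) ∈
    {p : Ω × (Fin n → ℝ) | ∃ o, P o ∧ A.freeze.next n p.1 p.2 = Sum.inr o}}

theorem mem_stopEventBefore [Finite ι] [Finite κ] (A : Algorithm Ω ι κ) (P : (κ → ι) → Prop)
    (n : ℕ) (q : Ω × (ℕ → ι → ℝ)) :
    q ∈ A.stopEventBefore P n ↔ ∃ t ≤ n, ∃ o, A.StopsWith q.1 q.2 t o ∧ P o := by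
  change (∃ o, P o ∧ A.freeze.next n q.1 (A.freeze.observed q.1 q.2 n) = Sum.inr o) ↔ _
  simp only [freeze_next_eq_inr_iff]
  exact ⟨fun ⟨o, ho, t, ht, hs⟩ => ⟨t, ht, o, hs, ho⟩, fun ⟨t, ht, o, hs, ho⟩ => ⟨o, ho, t, ht, hs⟩⟩

theorem stopEvent_eq_iUnion [Finite ι] [Finite κ] (A : Algorithm Ω ι κ) (P : (κ → ι) → Prop) :
    A.stopEvent P = ⋃ n, A.stopEventBefore P n := by
  ext q
  simp only [Set.mem_iUnion, mem_stopEventBefore]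
  exact ⟨fun ⟨t, o, h⟩ => ⟨t, t, le_rfl, o, h⟩, fun ⟨_, t, _, o, h⟩ => ⟨t, o, h⟩⟩

theorem stopEventBefore_mono [Finite ι] [Finite κ] (A : Algorithm Ω ι κ) (P : (κ → ι) → Prop) :
    Monotone (A.stopEventBefore P) := by
  intro n n' hn q hq
  rw [mem_stopEventBefore] at hq ⊢
  obtain ⟨t, ht, h⟩ := hq
  exact ⟨t, ht.trans hn, h⟩

theorem measurableSet_stop_history [Finite ι] [Finite κ] (A : Algorithm Ω ι κ)
    (P : (κ → ι) → Prop) (n : ℕ) :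
    MeasurableSet {p : Ω × (Fin n → ℝ) | ∃ o, P o ∧ A.freeze.next n p.1 p.2 = Sum.inr o} := by
  have : {p : Ω × (Fin n → ℝ) | ∃ o, P o ∧ A.freeze.next n p.1 p.2 = Sum.inr o} =
      ⋃ o : κ → ι, {p | P o} ∩ {p | A.freeze.next n p.1 p.2 = Sum.inr o} := by
    ext p
    simp
  rw [this]
  exact MeasurableSet.iUnion fun o =>
    (MeasurableSet.const _).inter (A.freeze.measurable_next n (Sum.inr o))

theorem measurableSet_stopEvent [Fintype ι] [Finite κ] (A : Algorithm Ω ι κ)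
    (P : (κ → ι) → Prop) : MeasurableSet (A.stopEvent P) := by
  rw [stopEvent_eq_iUnion]
  exact MeasurableSet.iUnion fun n =>
    A.freeze.measurable_history n (A.measurableSet_stop_history P n)

/-- The expected number of samples of arm `a`. -/
noncomputable def armSamples [Fintype ι] [Finite κ] (A : Algorithm Ω ι κ) (Q : Measure Ω)
    (ν : Arms ι) (a : ι) : ℝ≥0∞ :=
  ∑' s, runLaw Q ν {q | A.freeze.next s q.1 (A.freeze.observed q.1 q.2 s) = Sum.inl a}

/-- The frozen algorithm samples at most one arm per round and none from the stopping time on. If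
there is no stop, the infimum on the right is over the empty set and equals `⊤`. -/
theorem sum_indicator_le_numSamples [Fintype ι] [Finite κ] (A : Algorithm Ω ι κ) (n : ℕ)
    (q : Ω × (ℕ → ι → ℝ)) :
    ∑ s ∈ Finset.range n, ∑ a,
      {q : Ω × (ℕ → ι → ℝ) | A.freeze.next s q.1 (A.freeze.observed q.1 q.2 s) =
        Sum.inl a}.indicator (fun _ => (1 : ℝ≥0∞)) q ≤ A.numSamples q.1 q.2 := by
  classical
  refine le_iInf₂ fun t ht => ?_
  obtain ⟨o, ho⟩ := ht
  have h (s : ℕ) : ∑ a, {q : Ω × (ℕ → ι → ℝ) |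
      A.freeze.next s q.1 (A.freeze.observed q.1 q.2 s) = Sum.inl a}.indicator (fun _ => (1 : ℝ≥0∞)) q ≤
        if s < t then 1 else 0 := by
    simp only [Set.indicator_apply, Set.mem_ofPred_eq]
    by_cases hb : ∃ b, A.freeze.next s q.1 (A.freeze.observed q.1 q.2 s) = Sum.inl b
    · obtain ⟨b, hb⟩ := hb
      have hst : s < t := by
        by_contra hc
        have := (A.freeze_next_eq_inr_iff q.1 q.2 s o).2 ⟨t, not_lt.1 hc, ho⟩
        simp [hb] at this
      simp [hst, hb]
    · simp [not_exists.1 hb]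
  calc _ ≤ ∑ s ∈ Finset.range n, if s < t then (1 : ℝ≥0∞) else 0 :=
        Finset.sum_le_sum fun s _ => h s
    _ = (((Finset.range n).filter (· < t)).card : ℝ≥0∞) := by simp
    _ ≤ (t : ℝ≥0∞) := by
        refine Nat.cast_le.2 ?_
        calc _ ≤ (Finset.range t).card := Finset.card_le_card fun s hs => by
              simpa using (Finset.mem_filter.1 hs).2
          _ = t := Finset.card_range t

theorem sum_armSamples_le [Fintype ι] [Finite κ] (A : Algorithm Ω ι κ) (Q : Measure Ω)
    (ν : Arms ι) : ∑ a, A.armSamples Q ν a ≤ expectedSamples Q A ν := by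
  unfold armSamples
  rw [← Summable.tsum_finsetSum fun _ _ => ENNReal.summable, ENNReal.tsum_eq_iSup_nat]
  refine iSup_le fun n => ?_
  calc _ = ∫⁻ q, ∑ s ∈ Finset.range n, ∑ a,
      {q : Ω × (ℕ → ι → ℝ) | A.freeze.next s q.1 (A.freeze.observed q.1 q.2 s) =
        Sum.inl a}.indicator (fun _ => (1 : ℝ≥0∞)) q ∂(runLaw Q ν) := by
        have hm (s : ℕ) (a : ι) := A.freeze.measurableSet_next_observed s (Sum.inl a)
        rw [lintegral_finsetSum _ fun s _ => Finset.measurable_fun_sum _ fun a _ =>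
          measurable_const.indicator (hm s a)]
        refine Finset.sum_congr rfl fun s _ => ?_
        rw [lintegral_finsetSum _ fun a _ => measurable_const.indicator (hm s a)]
        exact Finset.sum_congr rfl fun a _ => (lintegral_indicator_one (hm s a)).symm
    _ ≤ _ := lintegral_mono fun q => A.sum_indicator_le_numSamples n q

/-- A transportation inequality between two instances that differ in one arm. -/
theorem transportation [Fintype ι] [Finite κ] (A : Algorithm Ω ι κ) (Q : Measure Ω)
    [IsProbabilityMeasure Q] {ν ν' : Arms ι} {a : ι}
    (hne : ∀ b, b ≠ a → ν'.law b = ν.law b) {w w' : ℝ} (hw : ν.law a = bernoulliLaw w)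
    (hw' : ν'.law a = bernoulliLaw w') (h0 : 0 < w) (h1 : w < 1) (h0' : 0 < w') (h1' : w' < 1)
    (hfin : A.armSamples Q ν a ≠ ⊤) (P : (κ → ι) → Prop) {l : ℝ} (hl : 0 ≤ l) :
    l * (runLaw Q ν).real (A.stopEvent P) ≤
      (Real.exp l - 1) * (runLaw Q ν').real (A.stopEvent P) +
      (w - w') ^ 2 / (w' * (1 - w')) * (A.armSamples Q ν a).toReal := by
  have hlim : Filter.Tendsto (fun n => l * (runLaw Q ν).real (A.stopEventBefore P n)) Filter.atTop
      (nhds (l * (runLaw Q ν).real (A.stopEvent P))) := by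
    refine Filter.Tendsto.const_mul _ ?_
    rw [stopEvent_eq_iUnion]
    exact (ENNReal.tendsto_toReal (measure_ne_top _ _)).comp
      (tendsto_measure_iUnion_atTop (A.stopEventBefore_mono P))
  -- Only the left side needs a limit; the right side at horizon `n` is bounded uniformly in `n`.
  refine le_of_tendsto' hlim fun n => ?_
  refine (A.freeze.transportation_horizon Q hne hw hw' h0 h1 h0' h1' n
    (A.measurableSet_stop_history P n) l).trans ?_
  refine add_le_add ?_ ?_
  · refine mul_le_mul_of_nonneg_left ?_ (by linarith [Real.add_one_le_exp l])
    refine measureReal_mono ?_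
    rw [stopEvent_eq_iUnion]
    exact Set.subset_iUnion (A.stopEventBefore P) n
  · refine mul_le_mul_of_nonneg_left ?_
      (div_nonneg (sq_nonneg _) (mul_nonneg h0'.le (by linarith)))
    simp only [measureReal_def]
    rw [← ENNReal.toReal_sum fun _ _ => measure_ne_top _ _]
    exact ENNReal.toReal_mono hfin (ENNReal.sum_le_tsum _)

end Algorithm

/-! ### The hard instances and their first errors. -/

variable {T m : ℕ} [NeZero m]

/-- The means of the hard instance with parameter `θ`: in group `t` the arm `0` is slightly better
than the others, and the arm `θ t`, unless it is `0`, is better still. -/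
noncomputable def hardMean (ε : ℝ) (θ : Fin T → Fin m) (a : Fin T × Fin m) : ℝ :=
  1 / 4 + 4 * ε * (a.1 : ℕ) + if a.2 = 0 then 2 * ε else if a.2 = θ a.1 then 4 * ε else 0

/-- The largest possible mean is `1/4 + 4ε(T - 1) + 4ε = 1/4 + 4εT`, which is `3/4` because `8εT =
1`. -/
theorem hardMean_bounds {ε : ℝ} (hε : 0 < ε) (hT : 8 * ε * T = 1) (θ : Fin T → Fin m)
    (a : Fin T × Fin m) : 1 / 4 ≤ hardMean ε θ a ∧ hardMean ε θ a ≤ 3 / 4 := by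
  have h1 : ((a.1 : ℕ) : ℝ) + 1 ≤ T := by exact_mod_cast a.1.2
  have h2 : (0 : ℝ) ≤ ((a.1 : ℕ) : ℝ) := Nat.cast_nonneg _
  have h3 := mul_le_mul_of_nonneg_left h1 hε.le
  have h4 := mul_nonneg hε.le h2
  unfold hardMean
  split_ifs <;> constructor <;> linarith

/-- The hard instance with parameter `θ`. -/
noncomputable def hardArms {ε : ℝ} (hε : 0 < ε) (hT : 8 * ε * T = 1) (θ : Fin T → Fin m) :
    Arms (Fin T × Fin m) :=
  bernoulliArms (hardMean ε θ) fun a =>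
    ⟨by linarith [(hardMean_bounds hε hT θ a).1], by linarith [(hardMean_bounds hε hT θ a).2]⟩

/-- Arms of earlier groups have mean at most `1/4 + 4εt`, while `(t, θ t)` has at least `1/4 + 4εt +
2ε`. Within the group the gap is `2ε` or `4ε`. -/
theorem isOptimal_hardArms {ε : ℝ} (hε : 0 < ε) (hT : 8 * ε * T = 1) (θ : Fin T → Fin m)
    {t : Fin T} {a : Fin T × Fin m}
    (h : (nestedInstance T m).IsOptimal (hardArms hε hT θ) ε t a) : a = (t, θ t) := by
  obtain ⟨⟨-, ha⟩, hopt⟩ := h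
  have hmem : ((t, θ t) : Fin T × Fin m) ∈ (nestedInstance T m).armsIn t :=
    ⟨by simp only [nestedInstance]; positivity, by simp [nestedInstance]⟩
  have hb := hopt _ hmem
  simp only [hardArms, weight_bernoulliArms, hardMean] at hb
  have hle : a.1 ≤ t := by
    simp only [nestedInstance] at ha
    have : ((a.1 : ℕ) : ℝ) ≤ (t : ℕ) := by linarith
    exact_mod_cast this
  rcases hle.lt_or_eq with hlt | heq
  · exfalso
    have h1 : ((a.1 : ℕ) : ℝ) + 1 ≤ (t : ℕ) := by exact_mod_cast hlt
    have h2 := mul_le_mul_of_nonneg_left h1 hε.le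
    split_ifs at hb <;> linarith
  · refine Prod.ext heq ?_
    by_contra hne
    rw [heq] at hb
    simp only [hne, if_false] at hb
    split_ifs at hb with h1 h2 h2
    · exact hne (h2.trans h1.symm)
    all_goals linarith

/-- The report is right in every group before `t`. -/
def RightBefore (θ : Fin T → Fin m) (t : Fin T) (out : Fin T → Fin T × Fin m) : Prop :=
  ∀ s < t, out s = (s, θ s)

section

variable {Ω : Type*} [MeasurableSpace Ω] (Q : Measure Ω) [IsProbabilityMeasure Q]
  (A : Algorithm Ω (Fin T × Fin m) (Fin T)) {ε δ : ℝ} (hε : 0 < ε) (hT : 8 * ε * T = 1)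

theorem one_sub_le_correct (hA : IsPAC Q A (nestedInstance T m) ε δ)
    (θ : Fin T → Fin m) :
    1 - δ ≤ (runLaw Q (hardArms hε hT θ)).real (A.stopEvent fun out => ∀ t, out t = (t, θ t)) := by
  rw [measureReal_def, ← ENNReal.ofReal_le_iff_le_toReal (measure_ne_top _ _)]
  refine (hA (hardArms hε hT θ)).trans (measure_mono ?_)
  rintro q ⟨t, out, hs, ho⟩
  exact ⟨t, out, hs, fun i => isOptimal_hardArms hε hT θ (ho i)⟩

/-- The probability that the first wrong report is the one for the interval `t`. -/
noncomputable def firstErrorProb (θ : Fin T → Fin m) (t : Fin T) : ℝ :=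
  (runLaw Q (hardArms hε hT θ)).real
    (A.stopEvent fun out => RightBefore θ t out ∧ out t ≠ (t, θ t))

/-- A run yields at most one report, and a report has at most one first error. These disjoint events
all miss the event of a fully correct report, which has probability at least `1 - δ`. -/
theorem sum_firstErrorProb_le (hA : IsPAC Q A (nestedInstance T m) ε δ)
    (θ : Fin T → Fin m) : ∑ t, firstErrorProb Q A hε hT θ t ≤ δ := by
  set F : Fin T → Set (Ω × (ℕ → Fin T × Fin m → ℝ)) := fun t =>
    A.stopEvent fun out => RightBefore θ t out ∧ out t ≠ (t, θ t) with hF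
  have hFm (t : Fin T) : MeasurableSet (F t) := A.measurableSet_stopEvent _
  have hdisj : Pairwise (Function.onFun Disjoint F) := by
    refine (pairwise_disjoint_on F).2 fun s t hst => ?_
    rw [Set.disjoint_left]
    rintro q ⟨n, o, hs, -, ho⟩ ⟨n', o', hs', hr, -⟩
    obtain ⟨-, rfl⟩ := A.stopsWith_unique hs hs'
    exact ho (hr s hst)
  have hU : MeasurableSet (⋃ t, F t) := MeasurableSet.iUnion hFm
  have h1 := one_sub_le_correct Q A hε hT hA θ
  have h2 : (A.stopEvent fun out => ∀ t, out t = (t, θ t)) ⊆ (⋃ t, F t)ᶜ := by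
    rintro q ⟨n, o, hs, ho⟩ hq
    obtain ⟨t, n', o', hs', -, ho'⟩ := Set.mem_iUnion.1 hq
    obtain ⟨-, rfl⟩ := A.stopsWith_unique hs hs'
    exact ho' (ho t)
  have h3 := h1.trans (measureReal_mono h2)
  rw [probReal_compl_eq_one_sub hU, measureReal_iUnion_fintype hdisj hFm] at h3
  have h4 : ∑ t, firstErrorProb Q A hε hT θ t =
      ∑ t, (runLaw Q (hardArms hε hT θ)).real (F t) := rfl
  linarith

theorem hardMean_update_sub (θ : Fin T → Fin m) {t : Fin T} (ht : θ t = 0) {j : Fin m}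
    (hj : j ≠ 0) : hardMean ε (Function.update θ t j) (t, j) = hardMean ε θ (t, j) + 4 * ε := by
  simp [hardMean, hj, ht]

theorem hardMean_update_of_ne (θ : Fin T → Fin m) {t : Fin T} (ht : θ t = 0) {j : Fin m}
    {b : Fin T × Fin m} (hb : b ≠ (t, j)) :
    hardMean ε (Function.update θ t j) b = hardMean ε θ b := by
  obtain ⟨s, i⟩ := b
  by_cases hs : s = t
  · subst hs
    have hij : i ≠ j := fun h => hb (by rw [h])
    by_cases hi : i = 0 <;> simp [hardMean, hi, hij, ht]
  · simp [hardMean, hs]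

/-- The two instances agree before `t`, so a report that is right before `t` and answers `(t, 0)` at
`t` is part of full success for `θ` but a first error at `t` for the updated parameter. -/
theorem le_firstErrorProb_add_armSamples (hA : IsPAC Q A (nestedInstance T m) ε δ)
    (θ : Fin T → Fin m) {t : Fin T} (ht : θ t = 0) {j : Fin m} (hj : j ≠ 0)
    (hfin : A.armSamples Q (hardArms hε hT θ) (t, j) ≠ ⊤) {l : ℝ} (hl : 0 ≤ l) :
    l * (1 - δ) ≤ (Real.exp l - 1) * firstErrorProb Q A hε hT (Function.update θ t j) t +
      86 * ε ^ 2 * (A.armSamples Q (hardArms hε hT θ) (t, j)).toReal := by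
  set w := hardMean ε θ (t, j) with hw
  set w' := hardMean ε (Function.update θ t j) (t, j) with hw'
  obtain ⟨b1, b2⟩ := hardMean_bounds hε hT θ (t, j)
  obtain ⟨b1', b2'⟩ := hardMean_bounds hε hT (Function.update θ t j) (t, j)
  rw [← hw] at b1 b2
  rw [← hw'] at b1' b2'
  have hne (b : Fin T × Fin m) (hb : b ≠ (t, j)) :
      (hardArms hε hT (Function.update θ t j)).law b = (hardArms hε hT θ).law b := by
    simp only [hardArms, bernoulliArms]
    rw [hardMean_update_of_ne θ ht hb]
  have h := A.transportation Q (ν := hardArms hε hT θ)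
    (ν' := hardArms hε hT (Function.update θ t j)) hne (w := w) (w' := w') rfl rfl
    (by linarith) (by linarith) (by linarith) (by linarith) hfin
    (fun out => RightBefore θ t out ∧ out t = (t, 0)) hl
  have e1 : 1 - δ ≤ (runLaw Q (hardArms hε hT θ)).real
      (A.stopEvent fun out => RightBefore θ t out ∧ out t = (t, 0)) := by
    refine (one_sub_le_correct Q A hε hT hA θ).trans (measureReal_mono ?_)
    rintro q ⟨n, o, hs, ho⟩
    exact ⟨n, o, hs, fun s _ => ho s, by rw [ho t, ht]⟩
  have e2 : (runLaw Q (hardArms hε hT (Function.update θ t j))).real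
      (A.stopEvent fun out => RightBefore θ t out ∧ out t = (t, 0)) ≤
      firstErrorProb Q A hε hT (Function.update θ t j) t := by
    refine measureReal_mono ?_
    rintro q ⟨n, o, hs, hr, ho⟩
    refine ⟨n, o, hs, fun s hst => ?_, ?_⟩
    · rw [hr s hst, Function.update_of_ne hst.ne]
    · rw [ho, Function.update_self]
      exact fun h => hj (Prod.ext_iff.1 h).2.symm
  -- The shift is `4ε` and `w' (1 - w') ≥ 3/16`, so the quotient is at most `(256/3) ε²`, and `256/3
  -- < 86`.
  have e3 : (w - w') ^ 2 / (w' * (1 - w')) ≤ 86 * ε ^ 2 := by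
    have : w' = w + 4 * ε := hardMean_update_sub θ ht hj
    have hpos : 3 / 16 ≤ w' * (1 - w') := by nlinarith
    rw [div_le_iff₀ (by linarith)]
    have : (w - w') ^ 2 = 16 * ε ^ 2 := by rw [this]; ring
    nlinarith [sq_nonneg ε]
  calc l * (1 - δ) ≤ _ := mul_le_mul_of_nonneg_left e1 hl
    _ ≤ _ := h
    _ ≤ _ := add_le_add
      (mul_le_mul_of_nonneg_left e2 (by linarith [Real.add_one_le_exp l]))
      (mul_le_mul_of_nonneg_right e3 ENNReal.toReal_nonneg)

end

/-! ### Averaging over the prior. -/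

/-- The (unnormalised) weight of a parameter, a product over the groups: the parameter `0` of a
group is as likely as all others together. -/
noncomputable def priorWeight (θ : Fin T → Fin m) : ℝ :=
  ∏ s, if θ s = 0 then ((m : ℝ) - 1) else 1

theorem priorWeight_pos (hm : 2 ≤ m) (θ : Fin T → Fin m) : 0 < priorWeight θ := by
  have : (2 : ℝ) ≤ m := by exact_mod_cast hm
  refine Finset.prod_pos fun s _ => ?_
  split_ifs <;> linarith

theorem priorWeight_update_zero (η : Fin T → Fin m) {t : Fin T} (ht : η t ≠ 0) :
    priorWeight (Function.update η t 0) = ((m : ℝ) - 1) * priorWeight η := by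
  unfold priorWeight
  rw [← Finset.mul_prod_erase _ _ (Finset.mem_univ t),
    ← Finset.mul_prod_erase _ (fun s => if η s = 0 then ((m : ℝ) - 1) else 1) (Finset.mem_univ t)]
  simp only [Function.update_self, if_true, ht, if_false, one_mul]
  congr 1
  refine Finset.prod_congr rfl fun s hs => ?_
  rw [Function.update_of_ne (Finset.ne_of_mem_erase hs)]

/-- The pairs `(θ, j)` with `θ t = 0`, `j ≠ 0` correspond to the `η` with `η t ≠ 0`, and resetting
that coordinate to `0` multiplies the weight by `m - 1`. Averaged alternatives thus become an
average over the same prior. -/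
theorem sum_priorWeight_update (t : Fin T) (f : (Fin T → Fin m) → ℝ) :
    ∑ θ with θ t = 0, ∑ j with j ≠ 0, priorWeight θ * f (Function.update θ t j) =
      ((m : ℝ) - 1) * ∑ η with η t ≠ 0, priorWeight η * f η := by
  rw [← Finset.sum_product', Finset.mul_sum]
  refine Finset.sum_bij' (fun x _ => Function.update x.1 t x.2)
    (fun η _ => (Function.update η t 0, η t)) ?_ ?_ ?_ ?_ ?_
  · rintro ⟨θ, j⟩ h
    simpa using (Finset.mem_filter.1 (Finset.mem_product.1 h).2).2
  · intro η h
    simpa using h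
  · rintro ⟨θ, j⟩ h
    have h0 : θ t = 0 := (Finset.mem_filter.1 (Finset.mem_product.1 h).1).2
    have : Function.update θ t 0 = θ := by rw [← h0, Function.update_eq_self]
    simp [this]
  · intro η _
    simp
  · rintro ⟨θ, j⟩ h
    have h0 : θ t = 0 := (Finset.mem_filter.1 (Finset.mem_product.1 h).1).2
    have hj : j ≠ 0 := (Finset.mem_filter.1 (Finset.mem_product.1 h).2).2
    have h1 : Function.update θ t 0 = θ := by rw [← h0, Function.update_eq_self]
    have h2 := priorWeight_update_zero (Function.update θ t j) (t := t) (by simpa using hj)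
    rw [Function.update_idem, h1] at h2
    dsimp only
    rw [h2, mul_assoc]

theorem card_ne_zero : (((Finset.univ.filter fun j : Fin m => j ≠ 0).card : ℕ) : ℝ) = m - 1 := by
  rw [Finset.filter_ne', Finset.card_erase_of_mem (Finset.mem_univ _), Finset.card_univ,
    Fintype.card_fin, Nat.cast_sub NeZero.one_le, Nat.cast_one]

theorem sum_priorWeight_eq_zero (hm : 2 ≤ m) (t : Fin T) :
    ∑ θ : Fin T → Fin m with θ t = 0, priorWeight θ =
      (∑ θ : Fin T → Fin m, priorWeight θ) / 2 := by
  have hm' : (2 : ℝ) ≤ m := by exact_mod_cast hm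
  have h := sum_priorWeight_update (m := m) t fun _ => 1
  simp only [mul_one, Finset.sum_const, nsmul_eq_mul, card_ne_zero] at h
  rw [← Finset.mul_sum] at h
  have h' := mul_left_cancel₀ (by linarith) h
  have := Finset.sum_filter_add_sum_filter_not Finset.univ
    (fun θ : Fin T → Fin m => θ t = 0) priorWeight
  simp only [ne_eq] at h'
  linarith

theorem sum_ne_zero_armSamples_le {Ω : Type*} [MeasurableSpace Ω] (Q : Measure Ω)
    (A : Algorithm Ω (Fin T × Fin m) (Fin T)) {ε : ℝ} (hε : 0 < ε) (hT : 8 * ε * T = 1) {X : ℝ} (θ : Fin T → Fin m)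
    (hX : ∑ a, (A.armSamples Q (hardArms hε hT θ) a).toReal ≤ X) :
    ∑ t, ∑ j with j ≠ 0, (A.armSamples Q (hardArms hε hT θ) (t, j)).toReal ≤ X := by
  refine le_trans ?_ hX
  rw [Fintype.sum_prod_type]
  exact Finset.sum_le_sum fun t _ => Finset.sum_le_sum_of_subset_of_nonneg
    (Finset.filter_subset _ _) fun _ _ _ => ENNReal.toReal_nonneg

section

variable {Ω : Type*} [MeasurableSpace Ω] (Q : Measure Ω) [IsProbabilityMeasure Q]
  (A : Algorithm Ω (Fin T × Fin m) (Fin T)) {ε δ : ℝ} (hε : 0 < ε) (hT : 8 * ε * T = 1)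

/-- The lower bound obtained from the instance with parameter `0`. -/
theorem samples_lower_bound_zero (hA : IsPAC Q A (nestedInstance T m) ε δ)
    (hfin : ∀ (θ : Fin T → Fin m) a, A.armSamples Q (hardArms hε hT θ) a ≠ ⊤) {X : ℝ}
    (hX : ∀ θ : Fin T → Fin m, ∑ a, (A.armSamples Q (hardArms hε hT θ) a).toReal ≤ X)
    {l : ℝ} (hl : 0 ≤ l) :
    T * ((m : ℝ) - 1) * (l * (1 - δ)) ≤
      (Real.exp l - 1) * (T * ((m : ℝ) - 1) * δ) + 86 * ε ^ 2 * X := by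
  have hpt (t : Fin T) (j : Fin m) (hj : j ≠ 0) : l * (1 - δ) ≤ (Real.exp l - 1) * δ +
      86 * ε ^ 2 * (A.armSamples Q (hardArms hε hT fun _ => 0) (t, j)).toReal := by
    have h := le_firstErrorProb_add_armSamples Q A hε hT hA (fun _ => 0) (t := t) rfl hj
      (hfin _ _) hl
    -- Each pair `(t, j)` has its own alternative, so each error is bounded by the full `δ`; no
    -- summation over `t` is gained here.
    have h1 : firstErrorProb Q A hε hT (Function.update (fun _ => 0) t j) t ≤ δ :=
      (Finset.single_le_sum (f := firstErrorProb Q A hε hT (Function.update (fun _ => 0) t j))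
        (fun _ _ => measureReal_nonneg) (Finset.mem_univ t)).trans
        (sum_firstErrorProb_le Q A hε hT hA _)
    have h2 := mul_le_mul_of_nonneg_left h1
      (by linarith [Real.add_one_le_exp l] : 0 ≤ Real.exp l - 1)
    linarith
  have hsum := Finset.sum_le_sum fun t (_ : t ∈ (Finset.univ : Finset (Fin T))) =>
    Finset.sum_le_sum fun j (hj : j ∈ Finset.univ.filter fun j : Fin m => j ≠ 0) =>
      hpt t j (Finset.mem_filter.1 hj).2
  simp only [Finset.sum_add_distrib, Finset.sum_const, nsmul_eq_mul, card_ne_zero,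
    Finset.card_univ, Fintype.card_fin, ← Finset.mul_sum] at hsum
  have := mul_le_mul_of_nonneg_left (sum_ne_zero_armSamples_le Q A hε hT _ (hX fun _ => 0))
    (by positivity : 0 ≤ 86 * ε ^ 2)
  linarith

/-- The lower bound obtained by averaging over all parameters. -/
theorem samples_lower_bound_average (hm : 2 ≤ m) (hA : IsPAC Q A (nestedInstance T m) ε δ)
    (hfin : ∀ (θ : Fin T → Fin m) a, A.armSamples Q (hardArms hε hT θ) a ≠ ⊤) {X : ℝ}
    (hX : ∀ θ : Fin T → Fin m, ∑ a, (A.armSamples Q (hardArms hε hT θ) a).toReal ≤ X)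
    {l : ℝ} (hl : 0 ≤ l) :
    T * ((m : ℝ) - 1) * (l * (1 - δ)) / 2 ≤
      (Real.exp l - 1) * (((m : ℝ) - 1) * δ) + 86 * ε ^ 2 * X := by
  have hm' : (2 : ℝ) ≤ m := by exact_mod_cast hm
  set N : (Fin T → Fin m) → Fin T × Fin m → ℝ :=
    fun θ a => (A.armSamples Q (hardArms hε hT θ) a).toReal with hN
  have hN0 (θ a) : 0 ≤ N θ a := ENNReal.toReal_nonneg
  set f := firstErrorProb Q A hε hT with hf
  have hf0 (θ t) : 0 ≤ f θ t := measureReal_nonneg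
  set Z := ∑ θ : Fin T → Fin m, priorWeight θ with hZ
  have hZ0 : 0 < Z := Finset.sum_pos (fun θ _ => priorWeight_pos hm θ) ⟨fun _ => 0, Finset.mem_univ _⟩
  have hexp : 0 ≤ Real.exp l - 1 := by linarith [Real.add_one_le_exp l]
  have hgroup (t : Fin T) : ((m : ℝ) - 1) * (l * (1 - δ)) * (Z / 2) ≤
      (Real.exp l - 1) * (((m : ℝ) - 1) * ∑ η, priorWeight η * f η t) +
      86 * ε ^ 2 * ∑ θ, priorWeight θ * ∑ j with j ≠ 0, N θ (t, j) := by
    have hsum := Finset.sum_le_sum fun θ (hθ : θ ∈ Finset.univ.filter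
        fun θ : Fin T → Fin m => θ t = 0) =>
      Finset.sum_le_sum fun j (hj : j ∈ Finset.univ.filter fun j : Fin m => j ≠ 0) =>
        mul_le_mul_of_nonneg_left (le_firstErrorProb_add_armSamples Q A hε hT hA θ
          (Finset.mem_filter.1 hθ).2 (Finset.mem_filter.1 hj).2 (hfin _ _) hl)
          (priorWeight_pos hm θ).le
    have e1 : ∑ θ : Fin T → Fin m with θ t = 0, ∑ j : Fin m with j ≠ 0,
        priorWeight θ * (l * (1 - δ)) = ((m : ℝ) - 1) * (l * (1 - δ)) * (Z / 2) := by
      simp only [Finset.sum_const, nsmul_eq_mul, card_ne_zero]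
      rw [← sum_priorWeight_eq_zero hm t, Finset.mul_sum]
      exact Finset.sum_congr rfl fun _ _ => by ring
    have e2 : ∑ θ : Fin T → Fin m with θ t = 0, ∑ j : Fin m with j ≠ 0,
        priorWeight θ * ((Real.exp l - 1) * f (Function.update θ t j) t +
          86 * ε ^ 2 * N θ (t, j)) =
        (Real.exp l - 1) * (((m : ℝ) - 1) * ∑ η with η t ≠ 0, priorWeight η * f η t) +
        86 * ε ^ 2 * ∑ θ with θ t = 0, priorWeight θ * ∑ j with j ≠ 0, N θ (t, j) := by
      rw [← sum_priorWeight_update t fun η => f η t]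
      simp only [Finset.mul_sum, ← Finset.sum_add_distrib]
      exact Finset.sum_congr rfl fun _ _ => Finset.sum_congr rfl fun _ _ => by ring
    rw [e1] at hsum
    -- The restrictions on coordinate `t` are dropped, so that the prior no longer depends on `t`
    -- and the sums over `t` and `θ` can be exchanged.
    refine (hsum.trans e2.le).trans (add_le_add ?_ ?_)
    · refine mul_le_mul_of_nonneg_left (mul_le_mul_of_nonneg_left ?_ (by linarith)) hexp
      exact Finset.sum_le_sum_of_subset_of_nonneg (Finset.filter_subset _ _)
        fun η _ _ => mul_nonneg (priorWeight_pos hm η).le (hf0 η t)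
    · refine mul_le_mul_of_nonneg_left ?_ (by positivity)
      exact Finset.sum_le_sum_of_subset_of_nonneg (Finset.filter_subset _ _)
        fun θ _ _ => mul_nonneg (priorWeight_pos hm θ).le (Finset.sum_nonneg fun _ _ => hN0 _ _)
  have hall := Finset.sum_le_sum fun t (_ : t ∈ (Finset.univ : Finset (Fin T))) => hgroup t
  have c1 : ∑ t, ∑ η, priorWeight η * f η t = ∑ η, priorWeight η * ∑ t, f η t := by
    simp only [Finset.mul_sum]
    exact Finset.sum_comm
  have c2 : ∑ t, ∑ θ, priorWeight θ * ∑ j with j ≠ 0, N θ (t, j) =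
      ∑ θ, priorWeight θ * ∑ t, ∑ j with j ≠ 0, N θ (t, j) := by
    rw [Finset.sum_comm]
    exact Finset.sum_congr rfl fun _ _ => (Finset.mul_sum _ _ _).symm
  rw [Finset.sum_add_distrib, ← Finset.mul_sum, ← Finset.mul_sum, ← Finset.mul_sum,
    ← Finset.mul_sum, c1, c2] at hall
  simp only [Finset.sum_const, nsmul_eq_mul, Finset.card_univ, Fintype.card_fin] at hall
  -- The decisive gain: for each `η` the errors of all `T` groups together cost a single `δ`.
  have k1 : ∑ η, priorWeight η * ∑ t, f η t ≤ Z * δ := by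
    rw [hZ, Finset.sum_mul]
    exact Finset.sum_le_sum fun η _ => mul_le_mul_of_nonneg_left
      (sum_firstErrorProb_le Q A hε hT hA η) (priorWeight_pos hm η).le
  have k2 : ∑ θ, priorWeight θ * ∑ t, ∑ j with j ≠ 0, N θ (t, j) ≤ Z * X := by
    rw [hZ, Finset.sum_mul]
    exact Finset.sum_le_sum fun θ _ => mul_le_mul_of_nonneg_left
      (sum_ne_zero_armSamples_le Q A hε hT θ (hX θ)) (priorWeight_pos hm θ).le
  have k3 := mul_le_mul_of_nonneg_left (mul_le_mul_of_nonneg_left k1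
    (by linarith : 0 ≤ (m : ℝ) - 1)) hexp
  have k4 := mul_le_mul_of_nonneg_left k2 (by positivity : 0 ≤ 86 * ε ^ 2)
  refine le_of_mul_le_mul_left ?_ hZ0
  linarith

end

/-! ### Choice of `l` and conclusion. -/

/-- If the hard instances all have finite expected numbers of samples, at most `X`, then `X` has
the order of `m T log (8 T / δ) / ε²`. -/
theorem samples_lower_bound {T m : ℕ} [NeZero m] (hT1 : 1 ≤ T) (hm : 2 ≤ m) {Ω : Type*}
    [MeasurableSpace Ω] (Q : Measure Ω) [IsProbabilityMeasure Q]
    (A : Algorithm Ω (Fin T × Fin m) (Fin T)) {ε δ δ₀ : ℝ} (hε : 0 < ε) (hT : 8 * ε * T = 1)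
    (hA : IsPAC Q A (nestedInstance T m) ε δ) (hδ : 0 < δ) (hδ' : δ ≤ δ₀) (hδ₀ : δ₀ < 1 / 2)
    (hfin : ∀ (θ : Fin T → Fin m) a, A.armSamples Q (hardArms hε hT θ) a ≠ ⊤) {X : ℝ}
    (hX : ∀ θ : Fin T → Fin m, ∑ a, (A.armSamples Q (hardArms hε hT θ) a).toReal ≤ X) :
    min (1 / 1376) ((1 - 2 * δ₀) ^ 2 / 3784) * (m * T * Real.log (8 * T / δ)) ≤ ε ^ 2 * X := by
  have hm' : (2 : ℝ) ≤ m := by exact_mod_cast hm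
  have hT' : (1 : ℝ) ≤ T := by exact_mod_cast hT1
  set L := Real.log (8 * T / δ) with hL
  have hL0 : 0 < L := Real.log_pos (by rw [lt_div_iff₀ hδ]; linarith)
  have hmT : (m : ℝ) * T / 2 ≤ T * ((m : ℝ) - 1) := by nlinarith
  have hmT0 : (0 : ℝ) < m * T := by positivity
  -- For `L ≥ 11` the choice `exp l = T / (4δ)` keeps the error term below `T (m - 1) / 4`, and `l =
  -- L - 5 log 2` satisfies `(l - 1) / 4 ≥ L / 8`. With `m - 1 ≥ m / 2` this gives the constant `1 /
  -- (16 · 86) = 1 / 1376`.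
  rcases le_or_gt 11 L with hL11 | hL11
  · have hlog : Real.log (T / (4 * δ)) = L - 5 * Real.log 2 := by
      have : (T : ℝ) / (4 * δ) = 8 * T / δ / 2 ^ 5 := by field_simp; norm_num
      rw [this, Real.log_div (by positivity) (by norm_num), Real.log_pow]
      norm_num
      exact hL.symm
    have hl2 := Real.log_two_lt_d9
    set l := Real.log (T / (4 * δ)) with hl
    have hexp : Real.exp l = T / (4 * δ) := Real.exp_log (by positivity)
    have h := samples_lower_bound_average Q A hε hT hm hA hfin hX (l := l) (by linarith)
    have h1 : (Real.exp l - 1) * δ ≤ T / 4 := by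
      have : T / (4 * δ) * δ = T / 4 := by field_simp
      rw [hexp, sub_mul, this]
      linarith
    have h2 := mul_le_mul_of_nonneg_right h1 (by linarith : 0 ≤ (m : ℝ) - 1)
    have h3 : l / 2 ≤ l * (1 - δ) := by nlinarith
    have h4 := mul_le_mul_of_nonneg_left h3 (by nlinarith : 0 ≤ T * ((m : ℝ) - 1))
    have h5 : T * ((m : ℝ) - 1) * (l / 4 - 1 / 4) ≤ 86 * ε ^ 2 * X := by linarith
    have h6 : m * T / 2 * (L / 8) ≤ T * ((m : ℝ) - 1) * (l / 4 - 1 / 4) :=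
      mul_le_mul hmT (by linarith) (by linarith) (by nlinarith)
    have h7 : min (1 / 1376) ((1 - 2 * δ₀) ^ 2 / 3784) * (m * T * L) ≤ 1 / 1376 * (m * T * L) :=
      mul_le_mul_of_nonneg_right (min_le_left _ _) (by positivity)
    linarith
  -- Here `L` is bounded by `11`, so a bound of order `m T` is enough. With `exp l - 1 ≤ l + l²` the
  -- gain is at least `l² (1 - δ) ≥ (1 - 2δ₀)² / 2`, and `3784 = 4 · 86 · 11`.
  · set l := 1 - 2 * δ with hl
    have hl0 : 0 < l := by linarith
    have h := samples_lower_bound_zero Q A hε hT hA hfin hX (l := l) hl0.le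
    have hexp : Real.exp l - 1 ≤ l + l ^ 2 := by
      have := (abs_le.1 (Real.abs_exp_sub_one_sub_id_le (x := l)
        (by rw [abs_of_pos hl0]; linarith))).2
      linarith
    have h1 := mul_le_mul_of_nonneg_right hexp hδ.le
    have h2 : (1 - 2 * δ₀) ^ 2 / 2 ≤ l * (1 - δ) - (Real.exp l - 1) * δ := by
      have e1 : (1 - 2 * δ₀) ^ 2 ≤ l ^ 2 := by
        have : 1 - 2 * δ₀ ≤ l := by linarith
        have : 0 ≤ 1 - 2 * δ₀ := by linarith
        gcongr
      have e2 : l * (1 - δ) - (l + l ^ 2) * δ = l ^ 2 * (1 - δ) := by rw [hl]; ring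
      nlinarith [sq_nonneg l]
    have h3 : m * T / 2 * ((1 - 2 * δ₀) ^ 2 / 2) ≤
        T * ((m : ℝ) - 1) * (l * (1 - δ) - (Real.exp l - 1) * δ) :=
      mul_le_mul hmT h2 (by positivity) (by nlinarith)
    have h4 : min (1 / 1376) ((1 - 2 * δ₀) ^ 2 / 3784) * (m * T * L) ≤
        (1 - 2 * δ₀) ^ 2 / 3784 * (m * T * 11) :=
      mul_le_mul (min_le_right _ _) (mul_le_mul_of_nonneg_left hL11.le hmT0.le) (by positivity)
        (by positivity)
    linarith

end BanditRange

theorem mainTheorem5 (δ₀ : ℝ) (hδ₀ : δ₀ < 1 / 2) :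
    ∃ c : ℝ, 0 < c ∧
      ∀ (T m : ℕ), 1 ≤ T → 2 ≤ m →
      ∀ (ε δ : ℝ), 1 / (8 * ε) = (T : ℝ) → 0 < δ → δ ≤ δ₀ →
      ∀ (Ω : Type*) [MeasurableSpace Ω] (Q : Measure Ω) [IsProbabilityMeasure Q]
        (A : BanditRange.Algorithm Ω (Fin T × Fin m) (Fin T)),
        BanditRange.IsPAC Q A (BanditRange.nestedInstance T m) ε δ →
        ∃ ν : BanditRange.Arms (Fin T × Fin m),
          ENNReal.ofReal (c * (((m * T : ℕ) : ℝ) / ε ^ 2 * Real.log (1 / (ε * δ)))) ≤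
            BanditRange.expectedSamples Q A ν := by
  have hsq : 0 < (1 - 2 * δ₀) ^ 2 := by
    have : 0 < 1 - 2 * δ₀ := by linarith
    positivity
  set c₀ : ℝ := min (1 / 1376) ((1 - 2 * δ₀) ^ 2 / 3784) with hc₀
  have hc₀pos : 0 < c₀ := lt_min (by norm_num) (by positivity)
  -- Halving `c₀` turns the non-strict bound of `samples_lower_bound` into a contradiction.
  refine ⟨c₀ / 2, by positivity, ?_⟩
  intro T m hT1 hm ε δ hεT hδ hδ' Ω _ Q _ A hA
  have : NeZero m := ⟨by omega⟩
  have hT' : (1 : ℝ) ≤ T := by exact_mod_cast hT1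
  have hm' : (2 : ℝ) ≤ m := by exact_mod_cast hm
  have hε : 0 < ε := by
    have : 0 < 1 / (8 * ε) := by linarith
    have := one_div_pos.1 this
    linarith
  have hT : 8 * ε * T = 1 := by
    rw [← hεT]
    field_simp
  have hlog : 1 / (ε * δ) = 8 * T / δ := by
    rw [← hεT]
    field_simp
  have hL0 : 0 < Real.log (8 * T / δ) := Real.log_pos (by rw [lt_div_iff₀ hδ]; linarith)
  rw [hlog]
  push_cast
  set X : ℝ := c₀ / 2 * ((m : ℝ) * T / ε ^ 2 * Real.log (8 * T / δ)) with hXdef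
  by_contra! hcon
  have hle (θ : Fin T → Fin m) := A.sum_armSamples_le Q (BanditRange.hardArms hε hT θ)
  have hlt (θ : Fin T → Fin m) := (hle θ).trans_lt (hcon _)
  -- Finiteness is needed before passing to reals, because `toReal` sends `⊤` to `0`.
  have hfin (θ : Fin T → Fin m) (a) : A.armSamples Q (BanditRange.hardArms hε hT θ) a ≠ ⊤ :=
    (ENNReal.sum_lt_top.1 ((hlt θ).trans ENNReal.ofReal_lt_top) a (Finset.mem_univ a)).ne
  have hX0 : 0 ≤ X := by positivity
  have hX (θ : Fin T → Fin m) :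
      ∑ a, (A.armSamples Q (BanditRange.hardArms hε hT θ) a).toReal ≤ X := by
    rw [← ENNReal.toReal_sum fun a _ => hfin θ a]
    exact ENNReal.toReal_le_of_le_ofReal hX0 (hlt θ).le
  have h := BanditRange.samples_lower_bound hT1 hm Q A hε hT hA hδ hδ' hδ₀ hfin hX
  have hXe : ε ^ 2 * X = c₀ / 2 * (m * T * Real.log (8 * T / δ)) := by
    rw [hXdef]
    field_simp
  rw [hXe, ← hc₀] at h
  have : 0 < c₀ * (m * T * Real.log (8 * T / δ)) := by positivity
  linarith
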